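/- Let $l,d,\lambda,Z_0,P,n_0>0$. For $r,s\in\mathbb{R}$ put $x=r-s$, $\rho=\sqrt{x^2+d^2}$ and $$G(r,s)=\frac{\mathrm{j}Z_0e^{\mathrm{j}2\pi\rho/\lambda}}{2\lambda\rho}\left[\frac{\mathrm{j}}{2\pi\rho/\lambda}\,\frac{d^2-2x^2}{\rho^2}+\frac{d^2}{\rho^2}-\frac{1}{(2\pi/\lambda)^2\rho^2}\,\frac{d^2-2x^2}{\rho^2}\right],$$ the $(3,3)$ entry of the free-space dyadic Green's function between the point $(0,0,s)$ of the source line and the point $(d,0,r)$ of the destination line. Continuous transceivers: let $T_E$ be the integral operator on $L^2([0,l];\mathbb{C})$ with kernel $K_E(r,r')=P\int_0^lG(r,s)\overline{G(r',s)}\,\mathrm{d}s$, and let $$I_0=\sum_k\log\left(1+\frac{\lambda_k}{n_0/2}\right),$$ where $\lambda_k$ are the eigenvalues of $T_E$ repeated according to multiplicity (they are real and nonnegative, the nonzero ones have finite multiplicity, and the sum converges). This is the mutual information between the white source current of power $P$ and the received field with white noise of level $n_0/2$. Discrete transceivers: for integers $m_1,m_2\ge 1$ place antennas at $s_j=(j-\tfrac12)l/m_1$,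 $1\le j\le m_1$, on the source and at $r_i=(i-\tfrac12)l/m_2$, $1\le i\le m_2$, on the destination. Let $\mathbf{H}=(G(r_i,s_j))_{i,j}\in\mathbb{C}^{m_2\times m_1}$, $\mathbf{K}_E''=\mathbf{H}(P\mathbf{I}_{m_1})\mathbf{H}^{\mathrm{H}}$ and $\mathbf{K}_N''=\frac{n_2}{2}\mathbf{I}_{m_2}$ with the noise level $$n_2=n_0\,\frac{\sum_{i=1}^{m_2}\sum_{j=1}^{m_1}|G(r_i,s_j)|^2}{\int_0^l\int_0^l|G(r,s)|^2\,\mathrm{d}r\,\mathrm{d}s},$$ and let $$I_2=I_2(m_1,m_2)=\log\frac{\det(\mathbf{K}_N''+\mathbf{K}_E'')}{\det\mathbf{K}_N''}$$ be the mutual information of this discrete MIMO channel. Then $I_2(m_1,m_2)\to I_0$ as $m_1,m_2\to\infty$. Moreover, there is a constant $C$, depending only on $l,d,\lambda,Z_0,P,n_0$, such that for all $m_1,m_2\ge1$ $$|I_0-I_2(m_1,m_2)|\le\frac{C}{\min(m_1,m_2)^2}.$$ -/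

import Mathlib

open MeasureTheory Filter Topology
open scoped ComplexConjugate

noncomputable section

namespace EIT

/-- Parameters of two parallel linear transceivers in free space: both have length `l` and lie at
distance `d`; `lam` is the wavelength, `Z0` the free-space impedance, `P` the power of the white
source current (autocorrelation `P δ(s - s')`) and `n0` the noise level of the white noise field
(autocorrelation `(n0 / 2) δ(r - r')`). -/
structure Model where
  l : ℝ
  d : ℝ
  lam : ℝ
  Z0 : ℝ
  P : ℝ
  n0 : ℝ
  l_pos : 0 < l
  d_pos : 0 < d
  lam_pos : 0 < lam
  Z0_pos : 0 < Z0
  P_pos : 0 < P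
  n0_pos : 0 < n0

namespace Model

variable (c : Model)

/-- Distance between the source point `(0, 0, s)` and the destination point `(d, 0, r)`. -/
def dist (r s : ℝ) : ℝ := √((r - s) ^ 2 + c.d ^ 2)

/-- The `(3, 3)` entry of the free-space dyadic Green's function, between the source point
`(0, 0, s)` and the destination point `(d, 0, r)`. -/
def G (r s : ℝ) : ℂ :=
  (Complex.I * (c.Z0 : ℂ) * Complex.exp (Complex.I * ((2 * Real.pi * c.dist r s / c.lam : ℝ) : ℂ)))
      / ((2 * c.lam * c.dist r s : ℝ) : ℂ)
    * (Complex.I / ((2 * Real.pi * c.dist r s / c.lam : ℝ) : ℂ)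
          * (((c.d ^ 2 - 2 * (r - s) ^ 2) / ((r - s) ^ 2 + c.d ^ 2) : ℝ) : ℂ)
        + ((c.d ^ 2 / ((r - s) ^ 2 + c.d ^ 2) : ℝ) : ℂ)
        - ((1 / ((2 * Real.pi / c.lam) ^ 2 * ((r - s) ^ 2 + c.d ^ 2))
            * ((c.d ^ 2 - 2 * (r - s) ^ 2) / ((r - s) ^ 2 + c.d ^ 2)) : ℝ) : ℂ))

/-- The autocorrelation `K_E(r, r') = P ∫₀ˡ G(r, s) G*(r', s) ds` of the received field. -/
def kernelE (r r' : ℝ) : ℂ :=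
  (c.P : ℂ) * ∫ s in (0 : ℝ)..c.l, c.G r s * conj (c.G r' s)

theorem sq_add_pos (r s : ℝ) : 0 < (r - s) ^ 2 + c.d ^ 2 := by
  have := c.d_pos
  positivity

theorem dist_pos (r s : ℝ) : 0 < c.dist r s := Real.sqrt_pos.2 (c.sq_add_pos r s)

theorem continuous_G : Continuous fun p : ℝ × ℝ => c.G p.1 p.2 := by
  have h1 : ∀ p : ℝ × ℝ, (p.1 - p.2) ^ 2 + c.d ^ 2 ≠ 0 := fun p => (c.sq_add_pos p.1 p.2).ne'
  have h2 : ∀ p : ℝ × ℝ, c.dist p.1 p.2 ≠ 0 := fun p => (c.dist_pos p.1 p.2).ne'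
  have hl := c.lam_pos.ne'
  have hpi := Real.pi_pos.ne'
  have hd : Continuous fun p : ℝ × ℝ => c.dist p.1 p.2 := by
    unfold dist
    fun_prop
  have h3 : ∀ p : ℝ × ℝ, ((2 * c.lam * c.dist p.1 p.2 : ℝ) : ℂ) ≠ 0 := fun p => by
    exact_mod_cast mul_ne_zero (mul_ne_zero two_ne_zero hl) (h2 p)
  have h4 : ∀ p : ℝ × ℝ, ((2 * Real.pi * c.dist p.1 p.2 / c.lam : ℝ) : ℂ) ≠ 0 := fun p => by
    exact_mod_cast div_ne_zero (mul_ne_zero (mul_ne_zero two_ne_zero hpi) (h2 p)) hl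
  have h5 : ∀ p : ℝ × ℝ, (2 * Real.pi / c.lam) ^ 2 * ((p.1 - p.2) ^ 2 + c.d ^ 2) ≠ 0 := fun p =>
    mul_ne_zero (pow_ne_zero _ (div_ne_zero (mul_ne_zero two_ne_zero hpi) hl)) (h1 p)
  unfold G
  refine Continuous.mul (Continuous.div (by fun_prop) (by fun_prop) h3) ?_
  refine Continuous.sub (Continuous.add (Continuous.mul
    (Continuous.div (by fun_prop) (by fun_prop) h4) ?_) ?_) ?_
  · exact Complex.continuous_ofReal.comp (Continuous.div (by fun_prop) (by fun_prop) h1)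
  · exact Complex.continuous_ofReal.comp (Continuous.div (by fun_prop) (by fun_prop) h1)
  · exact Complex.continuous_ofReal.comp (Continuous.mul
      (Continuous.div (by fun_prop) (by fun_prop) h5)
      (Continuous.div (by fun_prop) (by fun_prop) h1))

theorem continuous_kernelE : Continuous fun p : ℝ × ℝ => c.kernelE p.1 p.2 := by
  have hG := c.continuous_G
  unfold kernelE
  generalize c.G = g at hG
  have h : Continuous fun q : (ℝ × ℝ) × ℝ => g q.1.1 q.2 * conj (g q.1.2 q.2) := by
    have h1 := hG.comp (by fun_prop : Continuous fun q : (ℝ × ℝ) × ℝ => (q.1.1, q.2))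
    have h2 := hG.comp (by fun_prop : Continuous fun q : (ℝ × ℝ) × ℝ => (q.1.2, q.2))
    exact h1.mul (Complex.continuous_conj.comp h2)
  have h' := intervalIntegral.continuous_parametric_intervalIntegral_of_continuous'
    (f := fun (p : ℝ × ℝ) (s : ℝ) => g p.1 s * conj (g p.2 s)) (μ := volume) h 0 c.l
  exact continuous_const.mul h'

end Model

/-- Lebesgue measure on `[0, l]`. -/
abbrev segMeasure (l : ℝ) : Measure ℝ := volume.restrict (Set.Icc 0 l)

theorem kernel_bound (l : ℝ) {K : ℝ → ℝ → ℂ} (hK : Continuous fun p : ℝ × ℝ => K p.1 p.2) :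
    ∃ M : ℝ, ∀ r ∈ Set.Icc 0 l, ∀ r' ∈ Set.Icc 0 l, ‖K r r'‖ ≤ M := by
  obtain ⟨M, hM⟩ := (isCompact_Icc.prod isCompact_Icc :
    IsCompact (Set.Icc 0 l ×ˢ Set.Icc 0 l)).exists_bound_of_continuousOn hK.continuousOn
  exact ⟨M, fun r hr r' hr' => hM (r, r') ⟨hr, hr'⟩⟩

theorem integrable_kernel_mul (l : ℝ) {K : ℝ → ℝ → ℂ} (hK : Continuous fun p : ℝ × ℝ => K p.1 p.2)
    (φ : Lp ℂ 2 (segMeasure l)) (r : ℝ) :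
    Integrable (fun r' => K r r' * φ r') (segMeasure l) := by
  have hc : Continuous fun r' => K r r' := hK.comp (by fun_prop : Continuous fun r' => (r, r'))
  obtain ⟨M, hM⟩ := (isCompact_Icc : IsCompact (Set.Icc 0 l)).exists_bound_of_continuousOn
    hc.continuousOn
  have hφ : Integrable φ (segMeasure l) := (Lp.memLp φ).integrable (by norm_num)
  refine hφ.bdd_mul (c := M) hc.aestronglyMeasurable ?_
  filter_upwards [ae_restrict_mem measurableSet_Icc] with x hx using hM x hx

theorem memLp_kernel (l : ℝ) {K : ℝ → ℝ → ℂ} (hK : Continuous fun p : ℝ × ℝ => K p.1 p.2)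
    (φ : Lp ℂ 2 (segMeasure l)) :
    MemLp (fun r => ∫ r', K r r' * φ r' ∂(segMeasure l)) 2 (segMeasure l) := by
  obtain ⟨M, hM⟩ := kernel_bound l hK
  have hφ : Integrable φ (segMeasure l) := (Lp.memLp φ).integrable (by norm_num)
  have hmeas : StronglyMeasurable fun r => ∫ r', K r r' * φ r' ∂(segMeasure l) :=
    StronglyMeasurable.integral_prod_right
      (f := fun r r' => K r r' * φ r')
      (hK.stronglyMeasurable.mul ((Lp.stronglyMeasurable φ).comp_measurable measurable_snd))
  refine MemLp.of_bound hmeas.aestronglyMeasurable (∫ r', M * ‖φ r'‖ ∂(segMeasure l)) ?_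
  filter_upwards [ae_restrict_mem measurableSet_Icc] with r hr
  refine norm_integral_le_of_norm_le (hφ.norm.const_mul M) ?_
  filter_upwards [ae_restrict_mem measurableSet_Icc] with r' hr'
  rw [norm_mul]
  exact mul_le_mul_of_nonneg_right (hM r hr r' hr') (norm_nonneg _)

/-- The integral operator `(T φ)(r) = ∫₀ˡ K(r, r') φ(r') dr'` on `L²([0, l]; ℂ)`, for a continuous
kernel `K`. -/
def integralOperator (l : ℝ) (K : ℝ → ℝ → ℂ) (hK : Continuous fun p : ℝ × ℝ => K p.1 p.2) :
    Module.End ℂ (Lp ℂ 2 (segMeasure l)) where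
  toFun φ := (memLp_kernel l hK φ).toLp fun r => ∫ r', K r r' * φ r' ∂(segMeasure l)
  map_add' φ ψ := by
    rw [← MemLp.toLp_add]
    congr 1
    funext r
    rw [Pi.add_apply, ← integral_add (integrable_kernel_mul l hK φ r)
      (integrable_kernel_mul l hK ψ r)]
    refine integral_congr_ae ?_
    filter_upwards [Lp.coeFn_add φ ψ] with r' hr'
    rw [hr', Pi.add_apply, mul_add]
  map_smul' a φ := by
    rw [RingHom.id_apply, ← MemLp.toLp_const_smul]
    congr 1
    funext r
    rw [Pi.smul_apply, ← integral_smul]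
    refine integral_congr_ae ?_
    filter_upwards [Lp.coeFn_smul a φ] with r' hr'
    rw [hr', Pi.smul_apply, smul_eq_mul, smul_eq_mul]
    ring

namespace Model

variable (c : Model)

/-- The operator `T_E` on `L²([0, l]; ℂ)` with kernel `K_E`. -/
def TE : Module.End ℂ (Lp ℂ 2 (segMeasure c.l)) :=
  integralOperator c.l c.kernelE c.continuous_kernelE

/-- Total contribution of the eigenvalue `x` of `T_E`, counted with its multiplicity, to the mutual
information: `log (1 + x / (n0 / 2))`, once for every dimension of the eigenspace. It vanishes if
`x` is not an eigenvalue, and also at `x = 0`. -/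
def eigenInfo (x : ℝ) : ℝ :=
  (Module.finrank ℂ (c.TE.eigenspace (x : ℂ)) : ℝ) * Real.log (1 + x / (c.n0 / 2))

/-- The mutual information `I_0 = ∑ₖ log (1 + λₖ / (n0 / 2))` between continuous transceivers, where
`λₖ` are the eigenvalues of the (self-adjoint, nonnegative) operator `T_E` repeated with their
multiplicities. The sum is grouped by the value of the eigenvalue. -/
def I0 : ℝ := ∑' x : ℝ, c.eigenInfo x

/-- The centre `(i - 1/2) l / m` of the `i`-th of `m` equal parts of `[0, l]`; here `i` counts
from `0`. -/
def antenna (m : ℕ) (i : Fin m) : ℝ := ((i : ℝ) + 1 / 2) * c.l / m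

/-- Channel gains from the `m1` source antennas to the `m2` destination antennas. -/
def H (m1 m2 : ℕ) : Matrix (Fin m2) (Fin m1) ℂ :=
  Matrix.of fun i j => c.G (c.antenna m2 i) (c.antenna m1 j)

/-- The noise level of the discrete channel that gives both models the same signal-to-noise
ratio. -/
def n2 (m1 m2 : ℕ) : ℝ :=
  c.n0 * (∑ i : Fin m2, ∑ j : Fin m1, ‖c.G (c.antenna m2 i) (c.antenna m1 j)‖ ^ 2)
    / ∫ r in (0 : ℝ)..c.l, ∫ s in (0 : ℝ)..c.l, ‖c.G r s‖ ^ 2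

/-- Correlation matrix of the source currents. -/
def KJ (m1 : ℕ) : Matrix (Fin m1) (Fin m1) ℂ := (c.P : ℂ) • 1

/-- Correlation matrix of the received signals. -/
def KE (m1 m2 : ℕ) : Matrix (Fin m2) (Fin m2) ℂ :=
  c.H m1 m2 * c.KJ m1 * (c.H m1 m2).conjTranspose

/-- Correlation matrix of the received noise. -/
def KN (m1 m2 : ℕ) : Matrix (Fin m2) (Fin m2) ℂ := ((c.n2 m1 m2 / 2 : ℝ) : ℂ) • 1

/-- The mutual information `I_2 = log (det (K_N + K_E) / det K_N)` between discrete transceivers.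
Both determinants are positive reals as soon as `m1, m2 ≥ 1`. -/
def I2 (m1 m2 : ℕ) : ℝ :=
  Real.log ((c.KN m1 m2 + c.KE m1 m2).det / (c.KN m1 m2).det).re

end Model

end EIT

end

/-! Put b = n0/2, w_i = l/m_i, and let A be the integral operator with kernel G. Then T_E = P A A*
is nonnegative, its trace over orthonormal families is at most τ = P ∬|G|², and I_0 plays the role
of log det (1 + T_E/b). The noise level n_2 is such that I_2 = log det (1 + (q/b) N'), where N' = P
w_1 w_2 H Hᴴ and q = ∬|G|² / (w_1 w_2 ∑|G(r_i, s_j)|²). Let N be the matrix of T_E in the normalized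
indicators of the m_2 destination cells. Passing from I_0 to I_2 through N and N' costs three
errors, each O(w_1² + w_2²).

Compression: by `logDet_compression`, I_0 exceeds log det (1 + N/b) by an amount between 0 and (τ -
tr N)/b, so only the trace lost by the compression matters (`exists_trace_sub_bound`).

Quadrature: the entries of N and N' differ by O((w_1² + w_2²) w_2)
(`exists_compression_sub_scaledKE_bound`). Since both traces stay bounded, `logDet_one_add_le` turns
this into a bound that does not grow with the matrix size.

Normalization: q - 1 = O(w_1² + w_2²) by `exists_gainSum_bound`, and `logDet_one_add_smul_sub_le`
absorbs the factor q.

The matrix estimates all rest on the concavity of log det (`logDet_le`). The quadrature estimates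
rest on the midpoint rule, which is of second order because d > 0 keeps G smooth. -/

noncomputable section

namespace EIT

/-! ### Inequalities for log det of positive definite matrices -/

section LogDet

open Matrix
open scoped ComplexOrder MatrixOrder Matrix.Norms.L2Operator

variable {ι κ : Type*} [Fintype ι] [DecidableEq ι] [Fintype κ] [DecidableEq κ]

theorem ofReal_re_det {M : Matrix ι ι ℂ} (hM : M.PosDef) : ((M.det.re : ℝ) : ℂ) = M.det := by
  have h := hM.det_pos
  rw [Complex.lt_def] at h
  exact Complex.ext rfl h.2

theorem re_det_pos {M : Matrix ι ι ℂ} (hM : M.PosDef) : 0 < M.det.re := by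
  have h := hM.det_pos
  rw [Complex.lt_def] at h
  exact h.1

/-- The logarithm of the determinant of a positive definite matrix. -/
def logDet (M : Matrix ι ι ℂ) : ℝ := Real.log M.det.re

/-- This is log x ≤ x - 1 summed over the eigenvalues. -/
theorem logDet_le_trace {M : Matrix ι ι ℂ} (hM : M.PosDef) :
    logDet M ≤ (M.trace).re - Fintype.card ι := by
  have h1 : M.det.re = ∏ i, hM.1.eigenvalues i := by
    rw [hM.1.det_eq_prod_eigenvalues]
    exact_mod_cast Complex.ofReal_re (∏ i, hM.1.eigenvalues i)
  have h2 : M.trace.re = ∑ i, hM.1.eigenvalues i := by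
    rw [hM.1.trace_eq_sum_eigenvalues]
    exact_mod_cast Complex.ofReal_re (∑ i, hM.1.eigenvalues i)
  rw [logDet, h1, h2, Real.log_prod (fun i _ => (hM.eigenvalues_pos i).ne')]
  calc ∑ i, Real.log (hM.1.eigenvalues i) ≤ ∑ i, (hM.1.eigenvalues i - 1) :=
        Finset.sum_le_sum fun i _ => Real.log_le_sub_one_of_pos (hM.eigenvalues_pos i)
    _ = _ := by simp [Finset.sum_sub_distrib]

/-- Concavity of the logarithm of the determinant. -/
theorem logDet_le {M M' : Matrix ι ι ℂ} (hM : M.PosDef) (hM' : M'.PosDef) :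
    logDet M' ≤ logDet M + (M⁻¹ * (M' - M)).trace.re := by
  -- Writing M⁻¹ = B* B, the congruent matrix B M' B* has determinant det M' / det M and trace tr
  -- (M⁻¹ M'), so the trace bound for it is the tangent inequality at M.
  obtain ⟨B, hBu, hB⟩ : ∃ B : Matrix ι ι ℂ, IsUnit B ∧ M⁻¹ = star B * B := by
    have := Matrix.isStrictlyPositive_iff_posDef.2 hM.inv
    exact CStarAlgebra.isStrictlyPositive_iff_eq_star_mul_self.1 this
  have hK : (B * M' * star B).PosDef := (Matrix.IsUnit.posDef_star_right_conjugate_iff hBu).2 hM'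
  have hu : IsUnit M.det := (Matrix.isUnit_iff_isUnit_det M).1 hM.isUnit
  have h1 := logDet_le_trace hK
  have hdet : (B * M' * star B).det.re = M'.det.re * (M.det.re)⁻¹ := by
    have h2 : (B * M' * star B).det = M'.det * M.det⁻¹ := by
      rw [← Ring.inverse_eq_inv', ← det_nonsing_inv, hB, det_mul, det_mul, det_mul]
      ring
    rw [h2, ← ofReal_re_det hM, ← ofReal_re_det hM', ← Complex.ofReal_inv, ← Complex.ofReal_mul,
      Complex.ofReal_re]
    rfl
  have htr : (B * M' * star B).trace = (M⁻¹ * (M' - M)).trace + Fintype.card ι := by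
    rw [mul_sub, nonsing_inv_mul _ hu, trace_sub, trace_one, trace_mul_comm, ← mul_assoc, ← hB]
    ring
  rw [logDet, hdet, htr, Real.log_mul (re_det_pos hM').ne' (inv_pos.2 (re_det_pos hM)).ne',
    Real.log_inv] at h1
  simp only [Complex.add_re, Complex.natCast_re] at h1
  simp only [logDet]
  linarith

/-- With A = C* C, cyclicity gives tr (A B) = tr (C B C*), the trace of a positive semidefinite
matrix. -/
theorem trace_mul_nonneg {A B : Matrix ι ι ℂ} (hA : A.PosSemidef) (hB : B.PosSemidef) :
    0 ≤ (A * B).trace.re := by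
  obtain ⟨C, rfl⟩ : ∃ C : Matrix ι ι ℂ, A = star C * C := by
    exact CStarAlgebra.nonneg_iff_eq_star_mul_self.1 (Matrix.nonneg_iff_posSemidef.2 hA)
  rw [mul_assoc, trace_mul_comm]
  have := (hB.mul_mul_conjTranspose_same C).trace_nonneg
  rw [Complex.le_def] at this
  exact this.1

omit [Fintype ι] in
theorem posDef_one_add {X : Matrix ι ι ℂ} (hX : X.PosSemidef) : (1 + X).PosDef :=
  Matrix.PosDef.one.add_posSemidef hX

/-- With R = (1 + X)⁻¹ one has 1 - R = R (X + X²) R, a congruence of a positive semidefinite matrix.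
-/
theorem one_sub_inv_posSemidef {X : Matrix ι ι ℂ} (hX : X.PosSemidef) :
    (1 - (1 + X)⁻¹).PosSemidef := by
  have hM := posDef_one_add hX
  have hu : IsUnit (1 + X).det := (Matrix.isUnit_iff_isUnit_det _).1 hM.isUnit
  have hR : ((1 + X)⁻¹).IsHermitian := hM.inv.1
  have hXX : (X + X * X).PosSemidef := by
    refine hX.add ?_
    have := posSemidef_conjTranspose_mul_self X
    rwa [hX.1.eq] at this
  have h := hXX.mul_mul_conjTranspose_same (1 + X)⁻¹
  rw [hR.eq] at h
  convert h using 1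
  have e : X + X * X = (1 + X) * (1 + X) - (1 + X) := by noncomm_ring
  rw [e, mul_sub, sub_mul, ← mul_assoc, nonsing_inv_mul _ hu, one_mul, mul_nonsing_inv _ hu, one_mul]

theorem trace_inv_mul_le {X B : Matrix ι ι ℂ} (hX : X.PosSemidef) (hB : B.PosSemidef) :
    ((1 + X)⁻¹ * B).trace.re ≤ B.trace.re := by
  have := trace_mul_nonneg (one_sub_inv_posSemidef hX) hB
  rw [sub_mul, one_mul, trace_sub, Complex.sub_re] at this
  linarith

/-- If `Zᴴ Z ≤ diag d`, then the determinants of `1 + Z Zᴴ` and of `1 + diag d` are related by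
`det (1 + Z Zᴴ) ≤ det (1 + diag d) ≤ det (1 + Z Zᴴ) exp (∑ d - tr (Z Zᴴ))`. -/
theorem logDet_one_add_mul_conjTranspose {Z : Matrix ι κ ℂ} {d : κ → ℝ} (hd : ∀ k, 0 ≤ d k)
    (hZ : (diagonal (fun k => (d k : ℂ)) - Zᴴ * Z).PosSemidef) :
    logDet (1 + Z * Zᴴ) ≤ ∑ k, Real.log (1 + d k) ∧
      ∑ k, Real.log (1 + d k) ≤ logDet (1 + Z * Zᴴ) + (∑ k, d k - (Z * Zᴴ).trace.re) := by
  have hD : (diagonal (fun k => (d k : ℂ))).PosSemidef :=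
    Matrix.PosSemidef.diagonal fun k => by simpa using hd k
  have hX := posSemidef_conjTranspose_mul_self Z
  have hlogD : logDet (1 + diagonal (fun k => (d k : ℂ))) = ∑ k, Real.log (1 + d k) := by
    have h1 : (1 + diagonal (fun k => (d k : ℂ))).det = ((∏ k, (1 + d k) : ℝ) : ℂ) := by
      rw [← diagonal_one, diagonal_add, det_diagonal]
      push_cast
      rfl
    rw [logDet, h1, Complex.ofReal_re, Real.log_prod fun k _ => by linarith [hd k]]
  -- Sylvester's identity moves the determinant to the index set of `d`, where Zᴴ Z and diag d can
  -- be compared.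
  have hlogZ : logDet (1 + Z * Zᴴ) = logDet (1 + Zᴴ * Z) := by
    rw [logDet, logDet, det_one_add_mul_comm]
  have htr : (Z * Zᴴ).trace = (Zᴴ * Z).trace := trace_mul_comm _ _
  have htrD : (diagonal (fun k => (d k : ℂ))).trace.re = ∑ k, d k := by
    simp [trace_diagonal]
  rw [hlogZ, ← hlogD, htr]
  constructor
  -- The upper bound uses the tangent at 1 + diag d; the lower bound below uses the tangent at 1 +
  -- Zᴴ Z, whose inverse is at most 1.
  · have h1 := logDet_le (posDef_one_add hD) (posDef_one_add hX)
    have h2 := trace_mul_nonneg (posDef_one_add hD).inv.posSemidef hZ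
    have h3 : (1 + Zᴴ * Z - (1 + diagonal (fun k => (d k : ℂ))))
        = -(diagonal (fun k => (d k : ℂ)) - Zᴴ * Z) := by abel
    rw [h3, mul_neg, trace_neg, Complex.neg_re] at h1
    linarith
  · have h1 := logDet_le (posDef_one_add hX) (posDef_one_add hD)
    have h2 := trace_inv_mul_le hX hZ
    rw [add_sub_add_left_eq_sub] at h1
    rw [trace_sub, Complex.sub_re, htrD] at h2
    linarith

/-- A Hermitian matrix with entries of modulus at most `ε / card ι` is at most `ε`. -/
theorem posSemidef_smul_one_sub {D : Matrix ι ι ℂ} (hD : D.IsHermitian) {ε : ℝ}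
    (h : ∀ i j, ‖D i j‖ ≤ ε / Fintype.card ι) :
    (((ε : ℝ) : ℂ) • (1 : Matrix ι ι ℂ) - D).PosSemidef := by
  refine .of_dotProduct_mulVec_nonneg ?_ fun x => ?_
  · refine IsHermitian.sub ?_ hD
    rw [IsHermitian, conjTranspose_smul, conjTranspose_one]
    simp
  · rcases isEmpty_or_nonempty ι with hι | hι
    · simp [dotProduct]
    have hcard : (0 : ℝ) < Fintype.card ι := by exact_mod_cast Fintype.card_pos
    have hε : 0 ≤ ε / Fintype.card ι :=
      (norm_nonneg _).trans (h (Classical.arbitrary ι) (Classical.arbitrary ι))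
    have hH : (((ε : ℝ) : ℂ) • (1 : Matrix ι ι ℂ) - D).IsHermitian := by
      refine IsHermitian.sub ?_ hD
      rw [IsHermitian, conjTranspose_smul, conjTranspose_one]
      simp
    have him : (star x ⬝ᵥ ((((ε : ℝ) : ℂ) • (1 : Matrix ι ι ℂ) - D) *ᵥ x)).im = 0 :=
      hH.im_star_dotProduct_mulVec_self x
    rw [Complex.le_def]
    refine ⟨?_, by simpa using him.symm⟩
    -- By Cauchy–Schwarz (∑|x i|)² ≤ card ι · ∑|x i|², which cancels the denominator of the entry
    -- bound.
    have h1 : (star x ⬝ᵥ (D *ᵥ x)).re ≤ ε * ∑ i, ‖x i‖ ^ 2 := by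
      calc (star x ⬝ᵥ (D *ᵥ x)).re ≤ ‖star x ⬝ᵥ (D *ᵥ x)‖ := Complex.re_le_norm _
        _ ≤ ∑ i, ∑ j, ‖x i‖ * (ε / Fintype.card ι * ‖x j‖) := by
          refine (norm_sum_le _ _).trans (Finset.sum_le_sum fun i _ => ?_)
          rw [norm_mul, Pi.star_apply, norm_star, ← Finset.mul_sum]
          refine mul_le_mul_of_nonneg_left ((norm_sum_le _ _).trans ?_) (norm_nonneg _)
          refine Finset.sum_le_sum fun j _ => ?_
          rw [norm_mul]
          exact mul_le_mul_of_nonneg_right (h i j) (norm_nonneg _)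
        _ = ε / Fintype.card ι * (∑ i, ‖x i‖) ^ 2 := by
          rw [sq, Finset.sum_mul_sum, Finset.mul_sum]
          refine Finset.sum_congr rfl fun i _ => ?_
          rw [Finset.mul_sum]
          exact Finset.sum_congr rfl fun j _ => by ring
        _ ≤ ε / Fintype.card ι * (Fintype.card ι * ∑ i, ‖x i‖ ^ 2) := by
          refine mul_le_mul_of_nonneg_left ?_ hε
          exact sq_sum_le_card_mul_sum_sq
        _ = ε * ∑ i, ‖x i‖ ^ 2 := by field_simp
    have h2 : (star x ⬝ᵥ ((((ε : ℝ) : ℂ) • (1 : Matrix ι ι ℂ)) *ᵥ x)).re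
        = ε * ∑ i, ‖x i‖ ^ 2 := by
      rw [smul_mulVec, one_mulVec, dotProduct_smul, smul_eq_mul, Complex.re_ofReal_mul]
      congr 1
      simp only [dotProduct, Complex.re_sum, Pi.star_apply, RCLike.star_def]
      refine Finset.sum_congr rfl fun i _ => ?_
      rw [Complex.conj_mul', ← Complex.ofReal_pow, Complex.ofReal_re]
    rw [sub_mulVec, dotProduct_sub, Complex.sub_re, h2, Complex.zero_re]
    linarith

/-- Bounding tr (R (X - Y)), R = (1 + Y)⁻¹, by the operator bound ε alone would cost a factor card
ι. Instead R is split as 1 - (1 - R): the part 1 sees only the diagonal of X - Y, hence at most ε,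
and 1 - R = R Y has trace at most tr Y, so the operator bound costs only ε tr Y. -/
theorem logDet_one_add_le [Nonempty ι] {X Y : Matrix ι ι ℂ} (hX : X.PosSemidef) (hY : Y.PosSemidef) {ε : ℝ}
    (h : ∀ i j, ‖X i j - Y i j‖ ≤ ε / Fintype.card ι) :
    logDet (1 + X) ≤ logDet (1 + Y) + ε * (1 + Y.trace.re) := by
  have hcard : (0 : ℝ) < Fintype.card ι := by exact_mod_cast Fintype.card_pos
  have hε : 0 ≤ ε := by
    have := (norm_nonneg _).trans (h (Classical.arbitrary ι) (Classical.arbitrary ι))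
    rwa [le_div_iff₀ hcard, zero_mul] at this
  set R := (1 + Y)⁻¹ with hR
  have h1 := logDet_le (posDef_one_add hY) (posDef_one_add hX)
  rw [add_sub_add_left_eq_sub, ← hR] at h1
  have hu : IsUnit (1 + Y).det := (Matrix.isUnit_iff_isUnit_det _).1 (posDef_one_add hY).isUnit
  have hRY : 1 - R = R * Y := by
    have : R * (1 + Y) = 1 := nonsing_inv_mul _ hu
    rw [mul_add, mul_one] at this
    rw [← this]
    abel
  have htr : (X - Y).trace.re ≤ ε := by
    rw [trace, Complex.re_sum]
    calc ∑ i, ((X - Y).diag i).re ≤ ∑ _i : ι, ε / Fintype.card ι :=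
          Finset.sum_le_sum fun i _ => (Complex.re_le_norm _).trans (h i i)
      _ = ε := by
        rw [Finset.sum_const, Finset.card_univ, nsmul_eq_mul]
        field_simp
  have h2 : 0 ≤ ((1 - R) * (((ε : ℝ) : ℂ) • (1 : Matrix ι ι ℂ) - (Y - X))).trace.re := by
    refine trace_mul_nonneg (one_sub_inv_posSemidef hY)
      (posSemidef_smul_one_sub (hY.1.sub hX.1) fun i j => ?_)
    rw [Matrix.sub_apply, norm_sub_rev]
    exact h i j
  have h3 : ((1 - R) * (((ε : ℝ) : ℂ) • (1 : Matrix ι ι ℂ) - (Y - X))).trace.re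
      = ε * (R * Y).trace.re + (X - Y).trace.re - (R * (X - Y)).trace.re := by
    have : (1 - R) * (((ε : ℝ) : ℂ) • (1 : Matrix ι ι ℂ) - (Y - X))
        = ((ε : ℝ) : ℂ) • (R * Y) + (X - Y) - R * (X - Y) := by
      rw [← hRY]
      simp only [mul_sub, sub_mul, mul_smul_comm, mul_one, one_mul, smul_sub]
      abel
    rw [this, trace_sub, trace_add, trace_smul, Complex.sub_re, Complex.add_re, smul_eq_mul,
      Complex.re_ofReal_mul]
  have h4 := trace_inv_mul_le hY hY
  have h5 := mul_le_mul_of_nonneg_left h4 hε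
  rw [← hR] at h5
  linarith

/-- The tangent inequalities at 1 + X and at 1 + q X give the two sides; both inverses are at most
1. -/
theorem logDet_one_add_smul_sub_le {X : Matrix ι ι ℂ} (hX : X.PosSemidef) {q : ℝ} (hq : 0 ≤ q) :
    |logDet (1 + (q : ℂ) • X) - logDet (1 + X)| ≤ |q - 1| * X.trace.re := by
  have hqX : ((q : ℂ) • X).PosSemidef := hX.smul (by simpa using hq)
  have key : ∀ {Y : Matrix ι ι ℂ} (t : ℝ), Y.PosSemidef →
      ((1 + Y)⁻¹ * ((t : ℂ) • X)).trace.re ≤ |t| * X.trace.re := fun {Y} t hY => by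
    have h1 := trace_inv_mul_le hY hX
    have h2 := trace_mul_nonneg (posDef_one_add hY).inv.posSemidef hX
    rw [mul_smul_comm, trace_smul, smul_eq_mul, Complex.re_ofReal_mul]
    exact (mul_le_mul_of_nonneg_right (le_abs_self t) h2).trans
      (mul_le_mul_of_nonneg_left h1 (abs_nonneg t))
  have h1 := logDet_le (posDef_one_add hX) (posDef_one_add hqX)
  have h2 := logDet_le (posDef_one_add hqX) (posDef_one_add hX)
  rw [add_sub_add_left_eq_sub] at h1 h2
  have e1 : (q : ℂ) • X - X = ((q - 1 : ℝ) : ℂ) • X := by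
    rw [Complex.ofReal_sub, sub_smul, Complex.ofReal_one, one_smul]
  have e2 : X - (q : ℂ) • X = ((1 - q : ℝ) : ℂ) • X := by
    rw [Complex.ofReal_sub, sub_smul, Complex.ofReal_one, one_smul]
  rw [e1] at h1
  rw [e2] at h2
  have h3 := key (q - 1) hX
  have h4 := key (1 - q) hqX
  rw [abs_sub_comm 1 q] at h4
  rw [abs_le]
  constructor <;> linarith

end LogDet

/-! ### Nonnegative operators of finite trace and their compressions -/

section TraceClass

open Module

variable {H : Type} [NormedAddCommGroup H] [InnerProductSpace ℂ H]

/-- The sums `∑ ⟪v i, T (v i)⟫` over finite orthonormal families are bounded by `τ`. -/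
def TraceBound (T : End ℂ H) (τ : ℝ) : Prop :=
  ∀ (n : ℕ) (v : Fin n → H), Orthonormal ℂ v → ∑ i, (inner ℂ (v i) (T (v i))).re ≤ τ

theorem TraceBound.sum_le {T : End ℂ H} {τ : ℝ} (h : TraceBound T τ) {ι : Type*} {v : ι → H}
    (hv : Orthonormal ℂ v) (s : Finset ι) : ∑ i ∈ s, (inner ℂ (v i) (T (v i))).re ≤ τ := by
  have h1 := h s.card (fun i => v (s.equivFin.symm i))
    (hv.comp _ (Subtype.val_injective.comp s.equivFin.symm.injective))
  rw [← Finset.sum_coe_sort]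
  rwa [Equiv.sum_comp s.equivFin.symm (fun i : s => (inner ℂ (v i) (T (v i))).re)] at h1

/-- Positivity is tested at w - t T w with t = 1/(‖T‖ + 1): the quadratic term t² ⟪T w, T² w⟫ is at
most t ‖T w‖², which leaves t ‖T w‖² ≤ ⟪w, T w⟫. The summand 1 avoids division by zero. -/
theorem norm_sq_apply_le (T : H →L[ℂ] H) (hs : (T : End ℂ H).IsSymmetric)
    (hp : ∀ x, 0 ≤ (inner ℂ x (T x)).re) (w : H) :
    ‖T w‖ ^ 2 ≤ (‖T‖ + 1) * (inner ℂ w (T w)).re := by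
  have hM : 0 < ‖T‖ + 1 := by positivity
  set t : ℝ := (‖T‖ + 1)⁻¹ with ht
  have htM : t * (‖T‖ + 1) = 1 := inv_mul_cancel₀ hM.ne'
  have h1 := hp (w - (t : ℂ) • T w)
  have h2 : inner ℂ (T w) (T w) = ((‖T w‖ ^ 2 : ℝ) : ℂ) := by
    rw [inner_self_eq_norm_sq_to_K]
    norm_cast
  have h3 : inner ℂ w (T (T w)) = inner ℂ (T w) (T w) := (hs w (T w)).symm
  rw [map_sub, map_smul, inner_sub_left, inner_sub_right, inner_sub_right, inner_smul_left,
    inner_smul_left, inner_smul_right, inner_smul_right, h3, h2, Complex.conj_ofReal] at h1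
  have h4 : (inner ℂ (T w) (T (T w))).re ≤ (‖T‖ + 1) * ‖T w‖ ^ 2 := by
    have h5 : (inner ℂ (T w) (T (T w))).re ≤ ‖T w‖ * ‖T (T w)‖ := re_inner_le_norm (𝕜 := ℂ) _ _
    have h6 := T.le_opNorm (T w)
    nlinarith [norm_nonneg (T w), sq_nonneg ‖T w‖]
  simp only [Complex.sub_re, ← Complex.ofReal_mul, Complex.ofReal_re, Complex.re_ofReal_mul] at h1
  have h7 : t * (t * (inner ℂ (T w) (T (T w))).re) ≤ t * ‖T w‖ ^ 2 := by
    have : t * (inner ℂ (T w) (T (T w))).re ≤ t * ((‖T‖ + 1) * ‖T w‖ ^ 2) :=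
      mul_le_mul_of_nonneg_left h4 (by positivity)
    rw [← mul_assoc, htM, one_mul] at this
    exact mul_le_mul_of_nonneg_left this (by positivity)
  have h8 : t * ‖T w‖ ^ 2 ≤ (inner ℂ w (T w)).re := by linarith
  calc ‖T w‖ ^ 2 = (‖T‖ + 1) * (t * ‖T w‖ ^ 2) := by rw [← mul_assoc, mul_comm (‖T‖ + 1), htM, one_mul]
    _ ≤ _ := mul_le_mul_of_nonneg_left h8 hM.le

theorem orthonormal_finCons {n : ℕ} {v : Fin n → H} (hv : Orthonormal ℂ v) {w : H} (hw : ‖w‖ = 1)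
    (h : ∀ i, inner ℂ (v i) w = 0) : Orthonormal ℂ (Fin.cons w v : Fin (n + 1) → H) := by
  refine ⟨fun i => ?_, fun i j => ?_⟩
  · refine Fin.cases ?_ (fun i => ?_) i
    · simpa using hw
    · simpa using hv.1 i
  · refine Fin.cases ?_ (fun i => ?_) i <;> refine Fin.cases ?_ (fun j => ?_) j <;> intro hij
    · exact absurd rfl hij
    · simpa using inner_eq_zero_symm.1 (h j)
    · simpa using h i
    · simpa using hv.2 fun e => hij (by rw [e])

/-- An orthonormal basis of every eigenspace, for a nonzero real eigenvalue, is indexed by this. -/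
abbrev EigenIndex (T : End ℂ H) : Type :=
  Σ x : {x : ℝ // x ≠ 0}, Fin (finrank ℂ (T.eigenspace ((x : ℝ) : ℂ)))

variable [CompleteSpace H]

/-- A nonnegative symmetric operator of finite trace is compact. -/
theorem TraceBound.isCompactOperator {T : H →L[ℂ] H} {τ : ℝ} (htr : TraceBound (T : End ℂ H) τ)
    (hs : (T : End ℂ H).IsSymmetric) (hp : ∀ x, 0 ≤ (inner ℂ x (T x)).re) :
    IsCompactOperator T := by
  set S : Set ℝ := {x | ∃ (n : ℕ) (v : Fin n → H), Orthonormal ℂ v ∧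
    ∑ i, (inner ℂ (v i) (T (v i))).re = x} with hS
  have hbdd : BddAbove S := ⟨τ, by rintro _ ⟨n, v, hv, rfl⟩; exact htr n v hv⟩
  have hne : S.Nonempty := ⟨0, 0, Fin.elim0, ⟨fun i => i.elim0, fun i => i.elim0⟩, by simp⟩
  have key : T ∈ closure {f : H →L[ℂ] H | IsCompactOperator f} := by
    rw [Metric.mem_closure_iff]
    intro ε hε
    set M := ‖T‖ + 1 with hM
    have hMpos : 0 < M := by positivity
    -- For a family whose partial trace nearly attains the supremum, adjoining a unit vector z
    -- orthogonal to it adds at most (ε/2)²/M, so ‖T z‖ ≤ ε/2. Hence T is within ε of the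
    -- finite-rank operator T Q, Q being the projection onto the span.
    obtain ⟨_, ⟨n, v, hv, rfl⟩, hlt⟩ := exists_lt_of_lt_csSup hne
      (sub_lt_self (sSup S) (show 0 < (ε / 2) ^ 2 / M by positivity))
    have hbound : ∀ w, (∀ i, inner ℂ (v i) w = 0) → ‖T w‖ ≤ ε / 2 * ‖w‖ := by
      intro w hw
      rcases eq_or_ne w 0 with rfl | hw0
      · simp
      have hwn : 0 < ‖w‖ := norm_pos_iff.2 hw0
      set z : H := ((‖w‖⁻¹ : ℝ) : ℂ) • w with hz
      have hz1 : ‖z‖ = 1 := by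
        rw [hz, norm_smul, Complex.norm_real, norm_inv, norm_norm, inv_mul_cancel₀ hwn.ne']
      have hzv : ∀ i, inner ℂ (v i) z = 0 := fun i => by rw [hz, inner_smul_right, hw i, mul_zero]
      have h1 : ∑ i, (inner ℂ ((Fin.cons z v : Fin (n + 1) → H) i)
          (T ((Fin.cons z v : Fin (n + 1) → H) i))).re ≤ sSup S :=
        le_csSup hbdd ⟨n + 1, _, orthonormal_finCons hv hz1 hzv, rfl⟩
      rw [Fin.sum_univ_succ] at h1
      simp only [Fin.cons_zero, Fin.cons_succ] at h1
      have h2 := norm_sq_apply_le T hs hp z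
      have h3 : ‖T z‖ ^ 2 ≤ (ε / 2) ^ 2 := by
        refine h2.trans ?_
        have : (inner ℂ z (T z)).re ≤ (ε / 2) ^ 2 / M := by linarith
        rwa [le_div_iff₀ hMpos, mul_comm] at this
      have h4 : ‖T z‖ ≤ ε / 2 := le_of_sq_le_sq h3 (by positivity)
      rw [hz, map_smul, norm_smul, Complex.norm_real, norm_inv, norm_norm,
        inv_mul_le_iff₀ hwn] at h4
      linarith
    set V : Submodule ℂ H := Submodule.span ℂ (Set.range v) with hV
    have : FiniteDimensional ℂ V := FiniteDimensional.span_of_finite ℂ (Set.finite_range v)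
    set Q : H →L[ℂ] H := V.starProjection with hQ
    refine ⟨T.comp Q, ?_, ?_⟩
    · have : ProperSpace V := FiniteDimensional.proper ℂ V
      exact ((isCompactOperator_of_locallyCompactSpace_dom V.orthogonalProjectionOnto).clm_comp
        V.subtypeL).clm_comp T
    · rw [dist_eq_norm]
      refine lt_of_le_of_lt (ContinuousLinearMap.opNorm_le_bound _ (by positivity) fun x => ?_)
        (half_lt_self hε)
      have h1 : (T - T.comp Q) x = T (x - Q x) := by simp
      rw [h1]
      have h2 : x - Q x ∈ Vᗮ := V.sub_starProjection_mem_orthogonal x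
      refine (hbound _ fun i => h2 _ (Submodule.subset_span ⟨i, rfl⟩)).trans ?_
      refine mul_le_mul_of_nonneg_left ?_ (by positivity)
      have h3 : x - Q x = Vᗮ.starProjection x := (V.starProjection_orthogonal_val x).symm
      rw [h3]
      exact Vᗮ.norm_starProjection_apply_le x
  rw [isClosed_setOfPred_isCompactOperator.closure_eq] at key
  exact key

/-- This is the spectral theorem for compact symmetric operators. The family `u` need not be
complete, but T vanishes on its orthogonal complement, so the expansion of ⟪v, T w⟫ loses nothing.
-/
theorem exists_eigenbasis {T : End ℂ H} {τ : ℝ} (htr : TraceBound T τ)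
    (hs : T.IsSymmetric) (hp : ∀ x, 0 ≤ (inner ℂ x (T x)).re) :
    (∀ x : ℝ, x ≠ 0 → FiniteDimensional ℂ (T.eigenspace (x : ℂ))) ∧
    ∃ u : EigenIndex T → H,
      Orthonormal ℂ u ∧ (∀ k, T (u k) = ((k.1 : ℝ) : ℂ) • u k) ∧
      ∀ v w, HasSum (fun k => ((k.1 : ℝ) : ℂ) * (inner ℂ v (u k) * inner ℂ (u k) w))
        (inner ℂ v (T w)) := by
  set T' : H →L[ℂ] H := ⟨T, hs.continuous⟩ with hT'
  have hTT : (T' : End ℂ H) = T := rfl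
  have hc : IsCompactOperator T' := TraceBound.isCompactOperator (τ := τ) htr hs hp
  have hfd : ∀ x : ℝ, x ≠ 0 → FiniteDimensional ℂ (T.eigenspace (x : ℂ)) := fun x hx =>
    ContinuousLinearMap.finite_dimensional_eigenspace hc (x : ℂ) (by exact_mod_cast hx)
  refine ⟨hfd, ?_⟩
  have : ∀ x : {x : ℝ // x ≠ 0}, FiniteDimensional ℂ (T.eigenspace ((x : ℝ) : ℂ)) :=
    fun x => hfd x.1 x.2
  have hbot := ContinuousLinearMap.orthogonalComplement_iSup_eigenspaces_eq_bot hc hs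
  rw [hTT] at hbot
  have hfam : OrthogonalFamily ℂ (fun x : {x : ℝ // x ≠ 0} => T.eigenspace ((x : ℝ) : ℂ))
      fun x => (T.eigenspace ((x : ℝ) : ℂ)).subtypeₗᵢ :=
    hs.orthogonalFamily_eigenspaces.comp
      (f := fun x : {x : ℝ // x ≠ 0} => ((x : ℝ) : ℂ))
      (Complex.ofReal_injective.comp Subtype.val_injective)
  set u : EigenIndex T → H :=
    fun k => (stdOrthonormalBasis ℂ (T.eigenspace ((k.1 : ℝ) : ℂ)) k.2 : H) with hu
  have huo : Orthonormal ℂ u :=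
    hfam.orthonormal_sigma_orthonormal
      fun x => (stdOrthonormalBasis ℂ (T.eigenspace ((x : ℝ) : ℂ))).orthonormal
  have hTu : ∀ k, T (u k) = ((k.1 : ℝ) : ℂ) • u k := fun k =>
    End.mem_eigenspace_iff.1 (stdOrthonormalBasis ℂ (T.eigenspace ((k.1 : ℝ) : ℂ)) k.2).2
  have hker : ∀ w, (∀ k, inner ℂ (u k) w = 0) → T w = 0 := by
    intro w hw
    have hort : ∀ (x : ℝ), x ≠ 0 → w ∈ (T.eigenspace (x : ℂ))ᗮ := by
      intro x hx z hz
      have h1 := (stdOrthonormalBasis ℂ (T.eigenspace (((⟨x, hx⟩ : {x : ℝ // x ≠ 0}) : ℝ) : ℂ))).sum_repr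
        ⟨z, hz⟩
      have h2 : z = ∑ i, ((stdOrthonormalBasis ℂ (T.eigenspace
          (((⟨x, hx⟩ : {x : ℝ // x ≠ 0}) : ℝ) : ℂ))).repr ⟨z, hz⟩ i) • u ⟨⟨x, hx⟩, i⟩ := by
        conv_lhs => rw [show z = ((⟨z, hz⟩ : T.eigenspace (x : ℂ)) : H) from rfl, ← h1]
        simp [hu]
      rw [h2, sum_inner]
      exact Finset.sum_eq_zero fun i _ => by rw [inner_smul_left, hw, mul_zero]
    -- T w is orthogonal to every eigenspace: to the kernel by symmetry, and to the others because
    -- their orthogonal complements are invariant. The eigenspaces have dense span, so T w = 0.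
    have hmem : T w ∈ (⨆ μ, T.eigenspace μ)ᗮ := by
      rw [← Submodule.iInf_orthogonal, Submodule.mem_iInf]
      intro μ
      rcases eq_or_ne (T.eigenspace μ) ⊥ with hμ | hμ
      · rw [hμ]
        simp
      have hreal := hs.conj_eigenvalue_eq_self (End.hasEigenvalue_iff.2 hμ)
      rw [Complex.conj_eq_iff_real] at hreal
      obtain ⟨x, rfl⟩ := hreal
      rcases eq_or_ne x 0 with rfl | hx
      · intro z hz
        rw [End.mem_eigenspace_iff] at hz
        rw [← hs z w, hz]
        simp
      · exact hs.invariant_orthogonalComplement_eigenspace _ _ (hort x hx)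
    rw [hbot] at hmem
    simpa using hmem
  refine ⟨u, huo, hTu, fun v w => ?_⟩
  -- `u` is completed to a Hilbert basis; the added vectors are killed by T and drop out of
  -- Parseval's sum.
  obtain ⟨S, b, hS, hb⟩ := huo.toSubtypeRange.exists_hilbertBasis_extension
  have h1 := b.hasSum_inner_mul_inner v (T w)
  set f : _ → S := fun k => ⟨u k, hS ⟨k, rfl⟩⟩ with hf
  have hfinj : Function.Injective f := fun k k' h =>
    huo.linearIndependent.injective (congrArg Subtype.val h)
  have h2 : ∀ z, z ∉ Set.range f → inner ℂ v (b z) * inner ℂ (b z) (T w) = 0 := by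
    intro z hz
    rw [← hs (b z) w, hker (b z), inner_zero_left, mul_zero]
    intro k
    have h3 : u k = b (f k) := by rw [hb]
    rw [h3]
    exact b.orthonormal.2 fun e => hz ⟨k, e⟩
  rw [← hfinj.hasSum_iff h2] at h1
  convert h1 using 2 with k
  have h3 : b (f k) = u k := by rw [hb]
  simp only [Function.comp, h3]
  rw [← hs (u k) w, hTu, inner_smul_left, Complex.conj_ofReal]
  ring


/-- The matrix `⟪e i, T (e j)⟫`. -/
def compression (T : End ℂ H) {m : ℕ} (e : Fin m → H) : Matrix (Fin m) (Fin m) ℂ :=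
  Matrix.of fun i j => inner ℂ (e i) (T (e j))

/-! ### Log det of a compression against the sum over eigenvalues -/

section Compression

open Matrix
open scoped ComplexOrder

omit [CompleteSpace H] in
theorem compression_posSemidef {T : End ℂ H} (hs : T.IsSymmetric)
    (hp : ∀ x, 0 ≤ (inner ℂ x (T x)).re) {m : ℕ} (e : Fin m → H) :
    (compression T e).PosSemidef := by
  refine .of_dotProduct_mulVec_nonneg ?_ fun x => ?_
  · ext i j
    simp only [compression, conjTranspose_apply, of_apply]
    rw [RCLike.star_def, inner_conj_symm, hs]
  · have h1 : star x ⬝ᵥ (compression T e *ᵥ x)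
        = inner ℂ (∑ i, x i • e i) (T (∑ i, x i • e i)) := by
      simp only [map_sum, map_smul, sum_inner, inner_sum, inner_smul_left, inner_smul_right,
        dotProduct, mulVec, compression, of_apply, Pi.star_apply, RCLike.star_def, Finset.mul_sum]
      rw [Finset.sum_comm]
      exact Finset.sum_congr rfl fun i _ => Finset.sum_congr rfl fun j _ => by ring
    have h2 : (inner ℂ (∑ i, x i • e i) (T (∑ i, x i • e i))).im = 0 := by
      rw [← Complex.conj_eq_iff_im, inner_conj_symm, hs]
    rw [h1, Complex.le_def]
    exact ⟨hp _, h2.symm⟩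

/-- Comparison of the eigenvalues of a nonnegative operator of trace at most `τ` with its
compression to a finite orthonormal family. -/
theorem logDet_compression {T : End ℂ H} {τ b : ℝ} (hb : 0 < b) (htr : TraceBound T τ)
    (hs : T.IsSymmetric) (hp : ∀ x, 0 ≤ (inner ℂ x (T x)).re) :
    ∃ I : ℝ, HasSum (fun x : ℝ => (finrank ℂ (T.eigenspace (x : ℂ)) : ℝ) * Real.log (1 + x / b)) I ∧
      ∀ (m : ℕ) (e : Fin m → H), Orthonormal ℂ e →
        logDet (1 + ((b⁻¹ : ℝ) : ℂ) • compression T e) ≤ I ∧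
        I ≤ logDet (1 + ((b⁻¹ : ℝ) : ℂ) • compression T e)
          + (τ - (compression T e).trace.re) / b := by
  classical
  obtain ⟨-, u, huo, hTu, hsum⟩ := exists_eigenbasis htr hs hp
  have hinner : ∀ k, (inner ℂ (u k) (T (u k))).re = (k.1 : ℝ) := fun k => by
    rw [hTu, inner_smul_right, inner_self_eq_norm_sq_to_K, huo.1 k]
    simp
  have hnn : ∀ k : EigenIndex T,
      0 ≤ (k.1 : ℝ) := fun k => by
    rw [← hinner k]
    exact hp _
  have hle : ∀ s : Finset (EigenIndex T),
      ∑ k ∈ s, (k.1 : ℝ) ≤ τ := fun s => by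
    have := htr.sum_le huo s
    simpa only [hinner] using this
  have hsumm : Summable fun k : EigenIndex T => (k.1 : ℝ) :=
    summable_of_sum_le hnn hle
  have hlogsumm : Summable fun k : EigenIndex T => Real.log (1 + (k.1 : ℝ) / b) := by
    refine Summable.of_nonneg_of_le (fun k => Real.log_nonneg ?_) (fun k => ?_)
      (hsumm.div_const b)
    · have := div_nonneg (hnn k) hb.le
      linarith
    · have h1 := div_nonneg (hnn k) hb.le
      have := Real.log_le_sub_one_of_pos (show 0 < 1 + (k.1 : ℝ) / b by linarith)
      linarith
  obtain ⟨I, hI⟩ := hlogsumm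
  refine ⟨I, ?_, fun m e he => ?_⟩
  -- Grouping by eigenvalue produces the multiplicities; the value 0, absent from `EigenIndex`,
  -- contributes log 1 = 0.
  · have h1 := hI.sigma fun x => hasSum_fintype _
    simp only [Finset.sum_const, Finset.card_univ, Fintype.card_fin, nsmul_eq_mul] at h1
    exact (hasSum_subtype_iff_of_support_subset
      (f := fun x : ℝ => (finrank ℂ (T.eigenspace (x : ℂ)) : ℝ) * Real.log (1 + x / b))
      (s := {x | x ≠ 0}) fun x hx => by
        rintro rfl
        simp at hx).1 h1
  · set N := compression T e with hN
    have hNpos : (((b⁻¹ : ℝ) : ℂ) • N).PosSemidef :=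
      (compression_posSemidef hs hp e).smul (by simpa using hb.le)
    -- truncations
    obtain ⟨Z, hZ⟩ : ∃ Z : ∀ s : Finset (EigenIndex T), Matrix (Fin m) s ℂ, ∀ s i k,
        Z s i k = ((√((k.1.1 : ℝ) / b) : ℝ) : ℂ) * inner ℂ (e i) (u k) :=
      ⟨fun s => of fun i k => _, fun _ _ _ => rfl⟩
    have hsq : ∀ k : EigenIndex T,
        ((√((k.1 : ℝ) / b) : ℝ) : ℂ) * ((√((k.1 : ℝ) / b) : ℝ) : ℂ) = (((k.1 : ℝ) / b : ℝ) : ℂ) :=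
      fun k => by
        rw [← Complex.ofReal_mul, Real.mul_self_sqrt (div_nonneg (hnn k) hb.le)]
    have hZZ : ∀ s : Finset (EigenIndex T), Z s * (Z s)ᴴ = of fun i j => ∑ k ∈ s, ((b⁻¹ : ℝ) : ℂ) *
        (((k.1 : ℝ) : ℂ) * (inner ℂ (e i) (u k) * inner ℂ (u k) (e j))) := fun s => by
      ext i j
      rw [Matrix.mul_apply, of_apply]
      conv_rhs => rw [← Finset.sum_coe_sort]
      refine Finset.sum_congr rfl fun k _ => ?_
      rw [conjTranspose_apply, hZ, hZ, star_mul', RCLike.star_def,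
        Complex.conj_ofReal, inner_conj_symm]
      have := hsq k.1
      rw [Complex.ofReal_div] at this
      rw [Complex.ofReal_inv]
      linear_combination (inner ℂ (e i) (u k.1) * inner ℂ (u k.1) (e j)) * this
    -- Z s (Z s)ᴴ is the compression of b⁻¹ T truncated to the eigenvectors in `s`. The size m is
    -- fixed, so entrywise convergence carries over to determinant and trace.
    have hlim : Tendsto (fun s => Z s * (Z s)ᴴ) atTop (𝓝 (((b⁻¹ : ℝ) : ℂ) • N)) := by
      refine tendsto_pi_nhds.2 fun i => tendsto_pi_nhds.2 fun j => ?_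
      simp only [hZZ, of_apply]
      exact (hsum (e i) (e j)).mul_left ((b⁻¹ : ℝ) : ℂ)
    -- This is Bessel's inequality: at x the form equals ‖y‖² - ∑ |⟪e i, y⟫|² with y = ∑ √(λ_k / b)
    -- x_k u_k.
    have hpsd : ∀ s : Finset (EigenIndex T), (diagonal (fun k : s => ((((k.1.1 : ℝ) / b : ℝ)) : ℂ))
        - (Z s)ᴴ * Z s).PosSemidef := fun s => by
      refine .of_dotProduct_mulVec_nonneg ?_ fun x => ?_
      · refine IsHermitian.sub ?_ (isHermitian_conjTranspose_mul_self _)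
        rw [IsHermitian, diagonal_conjTranspose]
        congr 1
        ext k
        simp
      · set c : s → ℂ := fun k => ((√((k.1.1 : ℝ) / b) : ℝ) : ℂ) * x k with hc
        set y : H := ∑ k, c k • u k.1 with hy
        have hZx : ∀ i, (Z s *ᵥ x) i = inner ℂ (e i) y := fun i => by
          rw [hy, inner_sum]
          refine Finset.sum_congr rfl fun k _ => ?_
          rw [inner_smul_right, hc]
          beta_reduce
          rw [hZ]
          ring
        have h1 : star x ⬝ᵥ (((Z s)ᴴ * Z s) *ᵥ x) = ((∑ i, ‖inner ℂ (e i) y‖ ^ 2 : ℝ) : ℂ) := by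
          rw [← mulVec_mulVec, dotProduct_mulVec, vecMul_conjTranspose, star_star, dotProduct]
          push_cast
          refine Finset.sum_congr rfl fun i _ => ?_
          rw [Pi.star_apply, RCLike.star_def, Complex.conj_mul', hZx]
        have hyn : ((‖y‖ ^ 2 : ℝ) : ℂ) = ∑ k, conj (c k) * c k := by
          have h3 := (huo.comp (fun k : s => k.1) Subtype.val_injective).inner_sum c c Finset.univ
          have h4 := inner_self_eq_norm_sq_to_K (𝕜 := ℂ) y
          rw [Complex.ofReal_pow]
          exact h4.symm.trans h3
        have h2 : star x ⬝ᵥ (diagonal (fun k : s => ((((k.1.1 : ℝ) / b : ℝ)) : ℂ)) *ᵥ x)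
            = ((‖y‖ ^ 2 : ℝ) : ℂ) := by
          rw [hyn, dotProduct]
          refine Finset.sum_congr rfl fun k _ => ?_
          rw [mulVec_diagonal, Pi.star_apply, RCLike.star_def, hc, map_mul, Complex.conj_ofReal]
          linear_combination -(conj (x k) * x k) * hsq k.1
        rw [sub_mulVec, dotProduct_sub, h1, h2, ← Complex.ofReal_sub]
        have h5 := he.sum_inner_products_le y (s := Finset.univ)
        exact_mod_cast sub_nonneg.2 h5
    have hsand := fun s => logDet_one_add_mul_conjTranspose (Z := Z s)
      (d := fun k : s => (k.1.1 : ℝ) / b) (fun k => div_nonneg (hnn k.1) hb.le) (hpsd s)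
    have hlimlog : Tendsto (fun s => logDet (1 + Z s * (Z s)ᴴ)) atTop
        (𝓝 (logDet (1 + ((b⁻¹ : ℝ) : ℂ) • N))) := by
      have h1 : Tendsto (fun s => (1 + Z s * (Z s)ᴴ).det.re) atTop
          (𝓝 (1 + ((b⁻¹ : ℝ) : ℂ) • N).det.re) := by
        have hcont : Continuous fun A : Matrix (Fin m) (Fin m) ℂ => (1 + A).det.re :=
          Complex.continuous_re.comp ((continuous_const.add continuous_id).matrix_det)
        exact (hcont.tendsto _).comp hlim
      exact h1.log (re_det_pos (posDef_one_add hNpos)).ne'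
    have hlimtr : Tendsto (fun s => (Z s * (Z s)ᴴ).trace.re) atTop
        (𝓝 (N.trace.re / b)) := by
      have hcont : Continuous fun A : Matrix (Fin m) (Fin m) ℂ => A.trace.re :=
        Complex.continuous_re.comp continuous_id.matrix_trace
      have h1 := (hcont.tendsto _).comp hlim
      rw [trace_smul, smul_eq_mul, Complex.re_ofReal_mul, inv_mul_eq_div] at h1
      exact h1
    have hI' : Tendsto (fun s : Finset (EigenIndex T) =>
          ∑ k : s, Real.log (1 + (k.1.1 : ℝ) / b)) atTop (𝓝 I) := by
      have : Tendsto (fun s : Finset (EigenIndex T) =>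
          ∑ k ∈ s, Real.log (1 + (k.1 : ℝ) / b)) atTop (𝓝 I) := hI
      refine this.congr fun s => ?_
      rw [← Finset.sum_coe_sort]
    constructor
    · exact le_of_tendsto_of_tendsto' hlimlog hI' fun s => (hsand s).1
    · have h1 : Tendsto (fun s => logDet (1 + Z s * (Z s)ᴴ) + (τ / b - (Z s * (Z s)ᴴ).trace.re))
          atTop (𝓝 (logDet (1 + ((b⁻¹ : ℝ) : ℂ) • N) + (τ / b - N.trace.re / b))) :=
        hlimlog.add (tendsto_const_nhds.sub hlimtr)
      rw [sub_div]
      refine le_of_tendsto_of_tendsto' hI' h1 fun s => ?_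
      refine (hsand s).2.trans ?_
      have h2 : ∑ k : s, (k.1.1 : ℝ) / b ≤ τ / b := by
        rw [← Finset.sum_div, Finset.sum_coe_sort s (fun k : EigenIndex T => (k.1 : ℝ))]
        exact div_le_div_of_nonneg_right (hle s) hb.le
      linarith

end Compression

end TraceClass

/-! ### The midpoint rule and regularity of G -/

section Midpoint

/-- The linear Taylor term at x₀ integrates to zero by symmetry, and two applications of the mean
value inequality bound the remainder by M w². The constant is not optimized. -/
theorem norm_integral_sub_midpoint_le {f f' f'' : ℝ → ℂ} {x₀ w M : ℝ} (hw : 0 ≤ w)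
    (h1 : ∀ x, HasDerivAt f (f' x) x) (h2 : ∀ x, HasDerivAt f' (f'' x) x)
    (hM : ∀ x ∈ Set.Icc (x₀ - w / 2) (x₀ + w / 2), ‖f'' x‖ ≤ M) :
    ‖(∫ x in (x₀ - w / 2)..(x₀ + w / 2), f x) - w * f x₀‖ ≤ M * w ^ 3 := by
  set S := Set.Icc (x₀ - w / 2) (x₀ + w / 2) with hS
  have hx₀ : x₀ ∈ S := ⟨by linarith, by linarith⟩
  have hM0 : 0 ≤ M := (norm_nonneg _).trans (hM x₀ hx₀)
  have habs : ∀ x ∈ S, ‖x - x₀‖ ≤ w := fun x hx => by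
    rw [Real.norm_eq_abs, abs_le]
    constructor <;> linarith [hx.1, hx.2]
  have hb1 : ∀ x ∈ S, ‖f' x - f' x₀‖ ≤ M * w := fun x hx =>
    ((convex_Icc _ _).norm_image_sub_le_of_norm_hasDerivWithin_le
      (fun y _ => (h2 y).hasDerivWithinAt) hM hx₀ hx).trans
      (mul_le_mul_of_nonneg_left (habs x hx) hM0)
  have hF : ∀ x, HasDerivAt (fun x : ℝ => f x - ((x - x₀ : ℝ) : ℂ) * f' x₀) (f' x - f' x₀) x :=
    fun x => by
      have := (h1 x).fun_sub ((((hasDerivAt_id' x).sub_const x₀).ofReal_comp).mul_const (f' x₀))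
      simpa using this
  have hb2 : ∀ x ∈ S, ‖f x - ((x - x₀ : ℝ) : ℂ) * f' x₀ - f x₀‖ ≤ M * w * w := fun x hx => by
    have := (convex_Icc _ _).norm_image_sub_le_of_norm_hasDerivWithin_le
      (fun y _ => (hF y).hasDerivWithinAt) hb1 hx₀ hx
    simp only [sub_self, Complex.ofReal_zero, zero_mul, sub_zero] at this
    exact this.trans (mul_le_mul_of_nonneg_left (habs x hx) (by positivity))
  have hfc : Continuous f := continuous_iff_continuousAt.2 fun x => (h1 x).continuousAt
  have hint : ∫ x in (x₀ - w / 2)..(x₀ + w / 2), (f x - ((x - x₀ : ℝ) : ℂ) * f' x₀ - f x₀)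
      = (∫ x in (x₀ - w / 2)..(x₀ + w / 2), f x) - w * f x₀ := by
    have i1 : IntervalIntegrable f volume (x₀ - w / 2) (x₀ + w / 2) := hfc.intervalIntegrable _ _
    have i2 : IntervalIntegrable (fun x : ℝ => ((x - x₀ : ℝ) : ℂ) * f' x₀) volume
        (x₀ - w / 2) (x₀ + w / 2) := by
      apply Continuous.intervalIntegrable
      fun_prop
    have i3 : ∫ x in (x₀ - w / 2)..(x₀ + w / 2), ((x - x₀ : ℝ) : ℂ) = 0 := by
      rw [intervalIntegral.integral_ofReal, intervalIntegral.integral_sub (by simp) (by simp)]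
      norm_cast
      simp
      ring
    rw [intervalIntegral.integral_sub (i1.sub i2) (by simp), intervalIntegral.integral_sub i1 i2,
      intervalIntegral.integral_mul_const, i3, intervalIntegral.integral_const, zero_mul, sub_zero,
      Complex.real_smul]
    congr 2
    push_cast
    ring
  rw [← hint]
  have h := intervalIntegral.norm_integral_le_of_norm_le_const (a := x₀ - w / 2) (b := x₀ + w / 2)
    (f := fun x => f x - ((x - x₀ : ℝ) : ℂ) * f' x₀ - f x₀) (C := M * w * w) fun x hx => by
      rw [Set.uIoc_of_le (by linarith)] at hx
      exact hb2 x ⟨hx.1.le, hx.2⟩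
  refine h.trans (le_of_eq ?_)
  rw [show x₀ + w / 2 - (x₀ - w / 2) = w by ring, abs_of_nonneg hw]
  ring

namespace Model

variable (c : Model)

/-- Length of each of `m` equal parts of `[0, l]`. -/
def width (m : ℕ) : ℝ := c.l / m

theorem width_pos {m : ℕ} (hm : 1 ≤ m) : 0 < c.width m :=
  div_pos c.l_pos (by exact_mod_cast hm)

theorem natCast_mul_width {m : ℕ} (hm : 1 ≤ m) : m * c.width m = c.l :=
  mul_div_cancel₀ _ (by positivity)

/-- Left end of the `i`-th of `m` equal parts of `[0, l]`. -/
def cellLeft (m i : ℕ) : ℝ := i * c.width m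

theorem antenna_eq (m : ℕ) (i : Fin m) : c.antenna m i = c.cellLeft m i + c.width m / 2 := by
  simp only [antenna, cellLeft, width]
  ring

theorem cellLeft_succ (m i : ℕ) : c.cellLeft m (i + 1) = c.cellLeft m i + c.width m := by
  simp only [cellLeft]
  push_cast
  ring

theorem cell_subset {m : ℕ} (hm : 1 ≤ m) (i : Fin m) :
    Set.Icc (c.cellLeft m i) (c.cellLeft m (i + 1)) ⊆ Set.Icc 0 c.l := by
  have hw := c.width_pos hm
  refine Set.Icc_subset_Icc ?_ ?_
  · simp only [cellLeft]
    positivity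
  · rw [← c.natCast_mul_width hm]
    exact mul_le_mul_of_nonneg_right (by exact_mod_cast i.2) hw.le

theorem antenna_mem {m : ℕ} (i : Fin m) : c.antenna m i ∈ Set.Icc 0 c.l := by
  have hm : 1 ≤ m := Nat.one_le_of_lt i.2
  have hw := c.width_pos hm
  refine c.cell_subset hm i ⟨?_, ?_⟩
  · rw [antenna_eq]
    linarith
  · rw [antenna_eq, cellLeft_succ]
    linarith

theorem sum_integral_cells {m : ℕ} (hm : 1 ≤ m) {E : Type*} [NormedAddCommGroup E]
    [NormedSpace ℝ E] {f : ℝ → E} (hf : Continuous f) :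
    ∑ i : Fin m, ∫ x in (c.cellLeft m i)..(c.cellLeft m (i + 1)), f x = ∫ x in (0 : ℝ)..c.l, f x := by
  rw [Fin.sum_univ_eq_sum_range
    (fun i => ∫ x in (c.cellLeft m i)..(c.cellLeft m (i + 1)), f x) m,
    intervalIntegral.sum_integral_adjacent_intervals fun k _ => hf.intervalIntegrable _ _]
  rw [show c.cellLeft m 0 = 0 by simp [cellLeft], show c.cellLeft m m = c.l from
    c.natCast_mul_width hm]

theorem norm_integral_cell_sub_le {f f' f'' : ℝ → ℂ} {M : ℝ}
    (h1 : ∀ x, HasDerivAt f (f' x) x) (h2 : ∀ x, HasDerivAt f' (f'' x) x)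
    (hM : ∀ x ∈ Set.Icc 0 c.l, ‖f'' x‖ ≤ M) {m : ℕ} (i : Fin m) :
    ‖(∫ x in (c.cellLeft m i)..(c.cellLeft m (i + 1)), f x) - c.width m * f (c.antenna m i)‖
      ≤ M * c.width m ^ 3 := by
  have hm : 1 ≤ m := Nat.one_le_of_lt i.2
  have e1 : c.cellLeft m i = c.antenna m i - c.width m / 2 := by
    rw [antenna_eq]
    ring
  have e2 : c.cellLeft m (i + 1) = c.antenna m i + c.width m / 2 := by
    rw [antenna_eq, cellLeft_succ]
    ring
  have hsub := c.cell_subset hm i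
  rw [e1, e2] at hsub ⊢
  exact norm_integral_sub_midpoint_le (c.width_pos hm).le h1 h2 fun x hx => hM x (hsub hx)

theorem norm_integral_sub_sum_le {f f' f'' : ℝ → ℂ} {M : ℝ}
    (h1 : ∀ x, HasDerivAt f (f' x) x) (h2 : ∀ x, HasDerivAt f' (f'' x) x)
    (hM : ∀ x ∈ Set.Icc 0 c.l, ‖f'' x‖ ≤ M) {m : ℕ} (hm : 1 ≤ m) :
    ‖(∫ x in (0 : ℝ)..c.l, f x) - c.width m * ∑ i : Fin m, f (c.antenna m i)‖
      ≤ M * c.l * c.width m ^ 2 := by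
  have hfc : Continuous f := continuous_iff_continuousAt.2 fun x => (h1 x).continuousAt
  rw [← c.sum_integral_cells hm hfc, Finset.mul_sum, ← Finset.sum_sub_distrib]
  refine (norm_sum_le_of_le _ fun i _ => c.norm_integral_cell_sub_le h1 h2 hM i).trans ?_
  rw [Finset.sum_const, Finset.card_univ, Fintype.card_fin, nsmul_eq_mul]
  refine le_of_eq ?_
  rw [← c.natCast_mul_width hm]
  ring

/-- Translation invariance reduces all derivative bounds to one function of one variable on [-l, l].
-/
theorem G_eq_sub (r s : ℝ) : c.G r s = c.G (r - s) 0 := by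
  simp only [G, dist, sub_zero]

theorem contDiff_G : ContDiff ℝ 2 fun x => c.G x 0 := by
  have h1 : ∀ x : ℝ, x ^ 2 + c.d ^ 2 ≠ 0 := fun x => by simpa using (c.sq_add_pos x 0).ne'
  have h2 : ∀ x : ℝ, c.dist x 0 ≠ 0 := fun x => (c.dist_pos x 0).ne'
  have hl := c.lam_pos.ne'
  have hpi := Real.pi_pos.ne'
  have hd : ContDiff ℝ 2 fun x : ℝ => c.dist x 0 := by
    simp only [dist, sub_zero]
    exact ContDiff.sqrt (by fun_prop) h1
  have h3 : ∀ x : ℝ, ((2 * c.lam * c.dist x 0 : ℝ) : ℂ) ≠ 0 := fun x => by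
    exact_mod_cast mul_ne_zero (mul_ne_zero two_ne_zero hl) (h2 x)
  have h4 : ∀ x : ℝ, ((2 * Real.pi * c.dist x 0 / c.lam : ℝ) : ℂ) ≠ 0 := fun x => by
    exact_mod_cast div_ne_zero (mul_ne_zero (mul_ne_zero two_ne_zero hpi) (h2 x)) hl
  have h5 : ∀ x : ℝ, (2 * Real.pi / c.lam) ^ 2 * (x ^ 2 + c.d ^ 2) ≠ 0 := fun x =>
    mul_ne_zero (pow_ne_zero _ (div_ne_zero (mul_ne_zero two_ne_zero hpi) hl)) (h1 x)
  have hof : ∀ {f : ℝ → ℝ}, ContDiff ℝ 2 f → ContDiff ℝ 2 fun x => (f x : ℂ) := fun hf =>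
    Complex.ofRealCLM.contDiff.comp hf
  have hdiv : ∀ {f f' : ℝ → ℂ}, ContDiff ℝ 2 f → ContDiff ℝ 2 f' → (∀ x, f' x ≠ 0) →
      ContDiff ℝ 2 fun x => f x / f' x := fun hf hf' h0 => by
    simp only [div_eq_mul_inv]
    exact hf.mul (hf'.inv h0)
  have h6 : ContDiff ℝ 2 fun x : ℝ => ((2 * Real.pi * c.dist x 0 / c.lam : ℝ) : ℂ) :=
    hof ((contDiff_const.mul hd).div_const _)
  have h7 : ContDiff ℝ 2 fun x : ℝ => (c.d ^ 2 - 2 * x ^ 2) / (x ^ 2 + c.d ^ 2) :=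
    ContDiff.div (by fun_prop) (by fun_prop) h1
  simp only [G, sub_zero]
  refine ContDiff.mul (hdiv (contDiff_const.mul (contDiff_const.mul h6).cexp)
    (hof (contDiff_const.mul hd)) h3) ?_
  refine ContDiff.sub (ContDiff.add ((hdiv contDiff_const h6 h4).mul (hof h7)) (hof ?_)) (hof ?_)
  · exact ContDiff.div (by fun_prop) (by fun_prop) h1
  · exact (ContDiff.div (by fun_prop) (by fun_prop) h5).mul h7

theorem exists_deriv_G : ∃ g' g'' : ℝ → ℂ, (∀ x, HasDerivAt (fun x => c.G x 0) (g' x) x) ∧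
    (∀ x, HasDerivAt g' (g'' x) x) ∧ ∃ B : ℝ, 0 ≤ B ∧ ∀ x ∈ Set.Icc (-c.l) c.l,
      ‖c.G x 0‖ ≤ B ∧ ‖g' x‖ ≤ B ∧ ‖g'' x‖ ≤ B := by
  have h := c.contDiff_G
  have h1 : ContDiff ℝ 1 (deriv fun x => c.G x 0) :=
    (contDiff_succ_iff_deriv (n := 1).1 (by simpa [one_add_one_eq_two] using h)).2.2
  have h2 : Continuous (deriv (deriv fun x => c.G x 0)) := h1.continuous_deriv le_rfl
  refine ⟨deriv fun x => c.G x 0, deriv (deriv fun x => c.G x 0), fun x => ?_, fun x => ?_, ?_⟩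
  · exact (h.differentiable (by norm_num) x).hasDerivAt
  · exact (h1.differentiable (by norm_num) x).hasDerivAt
  · obtain ⟨B0, hB0⟩ := (isCompact_Icc : IsCompact (Set.Icc (-c.l) c.l)).exists_bound_of_continuousOn
      h.continuous.continuousOn
    obtain ⟨B1, hB1⟩ := (isCompact_Icc : IsCompact (Set.Icc (-c.l) c.l)).exists_bound_of_continuousOn
      h1.continuous.continuousOn
    obtain ⟨B2, hB2⟩ := (isCompact_Icc : IsCompact (Set.Icc (-c.l) c.l)).exists_bound_of_continuousOn
      h2.continuousOn
    have hl := c.l_pos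
    have h0 : 0 ≤ B0 := (norm_nonneg _).trans (hB0 0 ⟨by linarith, by linarith⟩)
    exact ⟨max B0 (max B1 B2), h0.trans (le_max_left _ _), fun x hx =>
      ⟨(hB0 x hx).trans (le_max_left _ _),
        (hB1 x hx).trans ((le_max_left _ _).trans (le_max_right _ _)),
        (hB2 x hx).trans ((le_max_right _ _).trans (le_max_right _ _))⟩⟩

/-- Uniform bounds for the gains and for the errors of the midpoint rule. -/
theorem exists_midpoint_bound : ∃ B : ℝ, 0 ≤ B ∧
    (∀ r ∈ Set.Icc 0 c.l, ∀ s ∈ Set.Icc 0 c.l, ‖c.G r s‖ ≤ B) ∧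
    (∀ s ∈ Set.Icc 0 c.l, ∀ (m : ℕ) (i : Fin m),
      ‖(∫ r in (c.cellLeft m i)..(c.cellLeft m (i + 1)), c.G r s)
        - c.width m * c.G (c.antenna m i) s‖ ≤ B * c.width m ^ 3) ∧
    (∀ s ∈ Set.Icc 0 c.l, ∀ (m : ℕ) (i : Fin m),
      ‖(∫ r in (c.cellLeft m i)..(c.cellLeft m (i + 1)), c.G r s * conj (c.G r s))
        - c.width m * (c.G (c.antenna m i) s * conj (c.G (c.antenna m i) s))‖
        ≤ B * c.width m ^ 3) ∧
    (∀ r ∈ Set.Icc 0 c.l, ∀ r' ∈ Set.Icc 0 c.l, ∀ m : ℕ, 1 ≤ m →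
      ‖(∫ s in (0 : ℝ)..c.l, c.G r s * conj (c.G r' s))
        - c.width m * ∑ j : Fin m, c.G r (c.antenna m j) * conj (c.G r' (c.antenna m j))‖
        ≤ B * c.l * c.width m ^ 2) := by
  obtain ⟨g', g'', h1, h2, B, hB0, hB⟩ := c.exists_deriv_G
  set g : ℝ → ℂ := fun x => c.G x 0 with hg
  have hG : ∀ r s, c.G r s = g (r - s) := c.G_eq_sub
  have hmem : ∀ r ∈ Set.Icc 0 c.l, ∀ s ∈ Set.Icc 0 c.l, r - s ∈ Set.Icc (-c.l) c.l :=
    fun r hr s hs => ⟨by linarith [hr.1, hs.2], by linarith [hr.2, hs.1]⟩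
  have hB' : ∀ r ∈ Set.Icc 0 c.l, ∀ s ∈ Set.Icc 0 c.l,
      ‖g (r - s)‖ ≤ B ∧ ‖g' (r - s)‖ ≤ B ∧ ‖g'' (r - s)‖ ≤ B :=
    fun r hr s hs => hB _ (hmem r hr s hs)
  -- derivatives of the translates
  have d1 : ∀ s x, HasDerivAt (fun r => g (r - s)) (g' (x - s)) x :=
    fun s x => (h1 (x - s)).comp_sub_const x s
  have d2 : ∀ s x, HasDerivAt (fun r => g' (r - s)) (g'' (x - s)) x :=
    fun s x => (h2 (x - s)).comp_sub_const x s
  have e1 : ∀ r x, HasDerivAt (fun s => g (r - s)) (-g' (r - x)) x :=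
    fun r x => (h1 (r - x)).comp_const_sub r x
  have e2 : ∀ r x, HasDerivAt (fun s => -g' (r - s)) (g'' (r - x)) x :=
    fun r x => by simpa using ((h2 (r - x)).comp_const_sub r x).fun_neg
  -- products
  have prod1 : ∀ {p p' q q' : ℝ → ℂ}, (∀ x, HasDerivAt p (p' x) x) →
      (∀ x, HasDerivAt q (q' x) x) → ∀ x, HasDerivAt (fun x => p x * conj (q x))
        (p' x * conj (q x) + p x * conj (q' x)) x := fun hp hq x =>
    (hp x).mul ((hq x).star)
  have prod2 : ∀ {p p' p'' q q' q'' : ℝ → ℂ}, (∀ x, HasDerivAt p (p' x) x) →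
      (∀ x, HasDerivAt p' (p'' x) x) → (∀ x, HasDerivAt q (q' x) x) →
      (∀ x, HasDerivAt q' (q'' x) x) → ∀ x,
        HasDerivAt (fun x => p' x * conj (q x) + p x * conj (q' x))
        (p'' x * conj (q x) + p' x * conj (q' x) + (p' x * conj (q' x) + p x * conj (q'' x))) x :=
    fun hp hp' hq hq' x => (prod1 hp' hq x).add (prod1 hp hq' x)
  have hmul : ∀ {z z' : ℂ}, ‖z‖ ≤ B → ‖z'‖ ≤ B → ‖z * conj z'‖ ≤ B * B := fun hz hz' => by
    rw [norm_mul, RCLike.norm_conj]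
    exact mul_le_mul hz hz' (norm_nonneg _) hB0
  have hfour : ∀ {z1 z2 z3 z4 : ℂ}, ‖z1‖ ≤ B * B → ‖z2‖ ≤ B * B → ‖z3‖ ≤ B * B → ‖z4‖ ≤ B * B →
      ‖z1 + z2 + (z3 + z4)‖ ≤ 4 * (B * B) := fun {z1 z2 z3 z4} i1 i2 i3 i4 => by
    have := norm_add_le (z1 + z2) (z3 + z4)
    have := norm_add_le z1 z2
    have := norm_add_le z3 z4
    linarith
  -- The second derivative of p q̄ is a sum of four products, each at most B².
  set B' := max B (4 * (B * B)) with hBB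
  refine ⟨B', hB0.trans (le_max_left _ _), fun r hr s hs => ?_, fun s hs m i => ?_,
    fun s hs m i => ?_, fun r hr r' hr' m hm => ?_⟩
  · rw [hG]
    exact (hB' r hr s hs).1.trans (le_max_left _ _)
  · simp only [hG]
    exact c.norm_integral_cell_sub_le (d1 s) (d2 s)
      (fun x hx => (hB' x hx s hs).2.2.trans (le_max_left _ _)) i
  · simp only [hG]
    refine c.norm_integral_cell_sub_le (prod1 (d1 s) (d1 s)) (prod2 (d1 s) (d2 s) (d1 s) (d2 s))
      (fun x hx => ?_) i
    obtain ⟨b0, b1, b2⟩ := hB' x hx s hs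
    exact (hfour (hmul b2 b0) (hmul b1 b1) (hmul b1 b1) (hmul b0 b2)).trans (le_max_right _ _)
  · simp only [hG]
    refine c.norm_integral_sub_sum_le (prod1 (e1 r) (e1 r')) (prod2 (e1 r) (e2 r) (e1 r') (e2 r'))
      (fun x hx => ?_) hm
    obtain ⟨b0, b1, b2⟩ := hB' r hr x hx
    obtain ⟨a0, a1, a2⟩ := hB' r' hr' x hx
    have b1' : ‖-g' (r - x)‖ ≤ B := by rwa [norm_neg]
    have a1' : ‖-g' (r' - x)‖ ≤ B := by rwa [norm_neg]
    exact (hfour (hmul b2 a0) (hmul b1' a1') (hmul b1' a1') (hmul b0 a2)).trans (le_max_right _ _)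

/-- The bracket has imaginary part α/κ. If it vanished then α = 0, and the real part would reduce to
d²/ρ² > 0. This makes the sum and the integral that define n_2 positive. -/
theorem G_ne_zero (r s : ℝ) : c.G r s ≠ 0 := by
  have h1 := c.sq_add_pos r s
  have h2 := c.dist_pos r s
  have hl := c.lam_pos
  have hZ := c.Z0_pos
  have hd := c.d_pos
  have hpi := Real.pi_pos
  unfold G
  refine mul_ne_zero (div_ne_zero (mul_ne_zero (mul_ne_zero Complex.I_ne_zero ?_)
    (Complex.exp_ne_zero _)) ?_) fun h => ?_
  · exact_mod_cast hZ.ne'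
  · exact_mod_cast (by positivity : (2 * c.lam * c.dist r s : ℝ) ≠ 0)
  set κ : ℝ := 2 * Real.pi * c.dist r s / c.lam with hκ
  set α : ℝ := (c.d ^ 2 - 2 * (r - s) ^ 2) / ((r - s) ^ 2 + c.d ^ 2) with hα
  have hκ0 : κ ≠ 0 := by positivity
  have him := congrArg Complex.im h
  have hre := congrArg Complex.re h
  rw [div_mul_eq_mul_div, mul_comm Complex.I, mul_div_right_comm, ← Complex.ofReal_div] at him hre
  simp only [Complex.sub_im, Complex.add_im, Complex.sub_re, Complex.add_re, Complex.im_ofReal_mul,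
    Complex.re_ofReal_mul, Complex.I_im, Complex.I_re, Complex.ofReal_im, Complex.ofReal_re,
    Complex.zero_im, Complex.zero_re] at him hre
  have hα0 : α = 0 := by
    have : α / κ = 0 := by linarith
    exact (div_eq_zero_iff.1 this).resolve_right hκ0
  rw [hα0] at hre
  have : 0 < c.d ^ 2 / ((r - s) ^ 2 + c.d ^ 2) := by positivity
  linarith

end Model

end Midpoint

/-! ### The operator T_E and step functions on the cells -/

theorem ae_prod_segMeasure {l : ℝ} {p : ℝ × ℝ → Prop}
    (h : ∀ x ∈ Set.Icc 0 l, ∀ y ∈ Set.Icc 0 l, p (x, y)) :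
    ∀ᵐ z ∂((segMeasure l).prod (segMeasure l)), p z := by
  rw [segMeasure, Measure.prod_restrict]
  filter_upwards [ae_restrict_mem (measurableSet_Icc.prod measurableSet_Icc)] with z hz
  exact h z.1 hz.1 z.2 hz.2

theorem integral_segMeasure {l : ℝ} (hl : 0 ≤ l) {E : Type*} [NormedAddCommGroup E]
    [NormedSpace ℝ E] (f : ℝ → E) : ∫ x, f x ∂(segMeasure l) = ∫ x in (0 : ℝ)..l, f x := by
  rw [intervalIntegral.integral_of_le hl, segMeasure, integral_Icc_eq_integral_Ioc]

namespace Model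

variable (c : Model)

theorem continuous_G_comp {X : Type*} [TopologicalSpace X] {f g : X → ℝ} (hf : Continuous f)
    (hg : Continuous g) : Continuous fun x => c.G (f x) (g x) := by
  have h := c.continuous_G
  generalize c.G = k at h ⊢
  exact h.comp (hf.prodMk hg)

/-- The field `∫ G(r, s) φ*(r) dr` that `φ*` on the destination line would produce at the point `s`
of the source line. -/
def backField (φ : Lp ℂ 2 (segMeasure c.l)) (s : ℝ) : ℂ :=
  ∫ r, c.G r s * conj (φ r) ∂(segMeasure c.l)

theorem integrable_Lp (φ : Lp ℂ 2 (segMeasure c.l)) : Integrable φ (segMeasure c.l) :=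
  (Lp.memLp φ).integrable (by norm_num)

theorem integrable_conj_Lp (φ : Lp ℂ 2 (segMeasure c.l)) :
    Integrable (fun r => conj (φ r)) (segMeasure c.l) :=
  Complex.conjCLE.toContinuousLinearMap.integrable_comp (c.integrable_Lp φ)

theorem stronglyMeasurable_backField (φ : Lp ℂ 2 (segMeasure c.l)) :
    StronglyMeasurable (c.backField φ) := by
  refine StronglyMeasurable.integral_prod_right (f := fun s r => c.G r s * conj (φ r)) ?_
  exact (c.continuous_G_comp continuous_snd continuous_fst).stronglyMeasurable.mul
    (Complex.continuous_conj.comp_stronglyMeasurable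
      ((Lp.stronglyMeasurable φ).comp_measurable measurable_snd))

theorem exists_backField_bound (φ : Lp ℂ 2 (segMeasure c.l)) :
    ∃ M, ∀ s ∈ Set.Icc 0 c.l, ‖c.backField φ s‖ ≤ M := by
  obtain ⟨B, -, hB, -⟩ := c.exists_midpoint_bound
  refine ⟨∫ r, B * ‖φ r‖ ∂(segMeasure c.l), fun s hs => ?_⟩
  refine norm_integral_le_of_norm_le ((c.integrable_Lp φ).norm.const_mul B) ?_
  filter_upwards [ae_restrict_mem measurableSet_Icc] with r hr
  rw [norm_mul, RCLike.norm_conj]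
  exact mul_le_mul_of_nonneg_right (hB r hr s hs) (norm_nonneg _)

theorem integral_kernelE_mul (ψ : Lp ℂ 2 (segMeasure c.l)) {r : ℝ} (hr : r ∈ Set.Icc 0 c.l) :
    ∫ r', c.kernelE r r' * ψ r' ∂(segMeasure c.l)
      = c.P * ∫ s, c.G r s * conj (c.backField ψ s) ∂(segMeasure c.l) := by
  obtain ⟨B, hB0, hB, -⟩ := c.exists_midpoint_bound
  have h1 : ∀ r', c.kernelE r r' * ψ r'
      = c.P * ∫ s, ψ r' * (c.G r s * conj (c.G r' s)) ∂(segMeasure c.l) := fun r' => by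
    rw [kernelE, ← integral_segMeasure c.l_pos.le, integral_const_mul]
    ring
  simp only [h1]
  rw [integral_const_mul]
  congr 1
  have hk : Continuous fun p : ℝ × ℝ => c.G r p.2 * conj (c.G p.1 p.2) :=
    (c.continuous_G_comp continuous_const continuous_snd).mul
      (Complex.continuous_conj.comp (c.continuous_G_comp continuous_fst continuous_snd))
  have hkB : ∀ᵐ p ∂((segMeasure c.l).prod (segMeasure c.l)),
      ‖c.G r p.2 * conj (c.G p.1 p.2)‖ ≤ B * B := by
    refine ae_prod_segMeasure fun x hx y hy => ?_
    rw [norm_mul, RCLike.norm_conj]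
    exact mul_le_mul (hB r hr y hy) (hB x hx y hy) (norm_nonneg _) hB0
  have hint : Integrable (fun p : ℝ × ℝ => ψ p.1 * (c.G r p.2 * conj (c.G p.1 p.2)))
      ((segMeasure c.l).prod (segMeasure c.l)) :=
    ((c.integrable_Lp ψ).comp_fst (segMeasure c.l)).mul_bdd hk.aestronglyMeasurable hkB
  rw [integral_integral_swap (f := fun r' s => ψ r' * (c.G r s * conj (c.G r' s))) hint]
  refine integral_congr_ae (ae_of_all _ fun s => ?_)
  simp only [backField]
  rw [← integral_conj, ← integral_const_mul]
  refine integral_congr_ae (ae_of_all _ fun r' => ?_)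
  simp only [map_mul, Complex.conj_conj]
  ring

/-- This is the factorization T_E = P A A* in weak form, by Fubini for a bounded kernel. Symmetry
and nonnegativity are read off from it. -/
theorem inner_TE (φ ψ : Lp ℂ 2 (segMeasure c.l)) :
    inner ℂ φ (c.TE ψ)
      = c.P * ∫ s, c.backField φ s * conj (c.backField ψ s) ∂(segMeasure c.l) := by
  obtain ⟨B, hB0, hB, -⟩ := c.exists_midpoint_bound
  obtain ⟨M, hM⟩ := c.exists_backField_bound ψ
  have h1 : inner ℂ φ (c.TE ψ) = ∫ r, c.P * ∫ s, conj (φ r) * (c.G r s * conj (c.backField ψ s))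
      ∂(segMeasure c.l) ∂(segMeasure c.l) := by
    rw [L2.inner_def]
    refine integral_congr_ae ?_
    filter_upwards [(memLp_kernel c.l c.continuous_kernelE ψ).coeFn_toLp,
      ae_restrict_mem measurableSet_Icc] with r h hr
    have h' : (c.TE ψ) r = ∫ r', c.kernelE r r' * ψ r' ∂(segMeasure c.l) := h
    rw [RCLike.inner_apply', h', c.integral_kernelE_mul ψ hr, integral_const_mul]
    ring
  rw [h1, integral_const_mul]
  congr 1
  have hint : Integrable
      (Function.uncurry fun r s => conj (φ r) * (c.G r s * conj (c.backField ψ s)))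
      ((segMeasure c.l).prod (segMeasure c.l)) := by
    refine ((c.integrable_conj_Lp φ).comp_fst (segMeasure c.l)).mul_bdd (c := B * M) ?_ ?_
    · exact (c.continuous_G.stronglyMeasurable.mul (Complex.continuous_conj.comp_stronglyMeasurable
        ((c.stronglyMeasurable_backField ψ).comp_measurable measurable_snd))).aestronglyMeasurable
    · refine ae_prod_segMeasure fun x hx y hy => ?_
      rw [norm_mul, RCLike.norm_conj]
      exact mul_le_mul (hB x hx y hy) (hM y hy) (norm_nonneg _) hB0
  rw [integral_integral_swap hint]
  refine integral_congr_ae (ae_of_all _ fun s => ?_)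
  beta_reduce
  rw [show c.backField φ s = ∫ r, c.G r s * conj (φ r) ∂(segMeasure c.l) from rfl,
    ← integral_mul_const]
  exact integral_congr_ae (ae_of_all _ fun r => by ring)

theorem TE_isSymmetric : c.TE.IsSymmetric := fun φ ψ => by
  rw [← inner_conj_symm, inner_TE, inner_TE, map_mul, ← integral_conj, Complex.conj_ofReal]
  congr 1
  refine integral_congr_ae (ae_of_all _ fun s => ?_)
  simp only [map_mul, Complex.conj_conj]
  ring

theorem re_inner_TE_self (φ : Lp ℂ 2 (segMeasure c.l)) :
    (inner ℂ φ (c.TE φ)).re = c.P * ∫ s, ‖c.backField φ s‖ ^ 2 ∂(segMeasure c.l) := by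
  have h : ∀ s, c.backField φ s * conj (c.backField φ s) = ((‖c.backField φ s‖ ^ 2 : ℝ) : ℂ) :=
    fun s => by rw [Complex.mul_conj', Complex.ofReal_pow]
  rw [inner_TE]
  simp only [h]
  rw [integral_complex_ofReal, ← Complex.ofReal_mul, Complex.ofReal_re]

theorem re_inner_TE_self_nonneg (φ : Lp ℂ 2 (segMeasure c.l)) :
    0 ≤ (inner ℂ φ (c.TE φ)).re := by
  rw [re_inner_TE_self]
  exact mul_nonneg c.P_pos.le (integral_nonneg fun s => sq_nonneg _)

/-- `backField (v i) s` is the inner product of v i with G(·, s), so this is Bessel's inequality. -/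
theorem sum_norm_sq_backField_le {n : ℕ} {v : Fin n → Lp ℂ 2 (segMeasure c.l)}
    (hv : Orthonormal ℂ v) (s : ℝ) :
    ∑ i, ‖c.backField (v i) s‖ ^ 2 ≤ ∫ r, ‖c.G r s‖ ^ 2 ∂(segMeasure c.l) := by
  have hc : Continuous fun r => c.G r s := c.continuous_G_comp continuous_id continuous_const
  obtain ⟨B, hB⟩ := (isCompact_Icc : IsCompact (Set.Icc 0 c.l)).exists_bound_of_continuousOn
    hc.continuousOn
  have hmem : MemLp (fun r => c.G r s) 2 (segMeasure c.l) :=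
    MemLp.of_bound hc.aestronglyMeasurable B (by
      filter_upwards [ae_restrict_mem measurableSet_Icc] with r hr using hB r hr)
  set g := hmem.toLp with hg
  have h1 : ∀ i, inner ℂ (v i) g = c.backField (v i) s := fun i => by
    rw [L2.inner_def]
    refine integral_congr_ae ?_
    filter_upwards [hmem.coeFn_toLp] with r hr
    rw [RCLike.inner_apply, hr]
  have h2 : ‖g‖ ^ 2 = ∫ r, ‖c.G r s‖ ^ 2 ∂(segMeasure c.l) := by
    have h3 : ((‖g‖ ^ 2 : ℝ) : ℂ) = ((∫ r, ‖c.G r s‖ ^ 2 ∂(segMeasure c.l) : ℝ) : ℂ) := by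
      rw [Complex.ofReal_pow]
      refine (inner_self_eq_norm_sq_to_K (𝕜 := ℂ) g).symm.trans ?_
      rw [L2.inner_def, ← integral_complex_ofReal]
      refine integral_congr_ae ?_
      filter_upwards [hmem.coeFn_toLp] with r hr
      rw [RCLike.inner_apply, hr, Complex.mul_conj', Complex.ofReal_pow]
    exact_mod_cast h3
  rw [← h2]
  simpa only [h1] using hv.sum_inner_products_le g (s := Finset.univ)

theorem continuous_integral_norm_sq_G :
    Continuous fun s => ∫ r in (0 : ℝ)..c.l, ‖c.G r s‖ ^ 2 := by
  refine intervalIntegral.continuous_parametric_intervalIntegral_of_continuous'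
    (f := fun s r => ‖c.G r s‖ ^ 2) ?_ 0 c.l
  exact (c.continuous_G_comp continuous_snd continuous_fst).norm.pow 2

/-- Bessel's inequality at each source point s is integrated over s. -/
theorem TE_traceBound :
    TraceBound c.TE (c.P * ∫ s in (0 : ℝ)..c.l, ∫ r in (0 : ℝ)..c.l, ‖c.G r s‖ ^ 2) := by
  intro n v hv
  have hi : ∀ i, Integrable (fun s => ‖c.backField (v i) s‖ ^ 2) (segMeasure c.l) := fun i => by
    obtain ⟨M, hM⟩ := c.exists_backField_bound (v i)
    refine Integrable.of_bound
      ((c.stronglyMeasurable_backField (v i)).norm.pow 2).aestronglyMeasurable (M ^ 2) ?_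
    filter_upwards [ae_restrict_mem measurableSet_Icc] with s hs
    rw [norm_pow, norm_norm]
    exact pow_le_pow_left₀ (norm_nonneg _) (hM s hs) 2
  simp only [re_inner_TE_self]
  rw [← Finset.mul_sum, ← integral_finsetSum _ fun i _ => hi i,
    ← integral_segMeasure c.l_pos.le (fun s => ∫ r in (0 : ℝ)..c.l, ‖c.G r s‖ ^ 2)]
  refine mul_le_mul_of_nonneg_left (integral_mono (integrable_finsetSum _ fun i _ => hi i) ?_
    fun s => ?_) c.P_pos.le
  · exact c.continuous_integral_norm_sq_G.continuousOn.integrableOn_compact isCompact_Icc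
  · rw [← integral_segMeasure c.l_pos.le]
    exact c.sum_norm_sq_backField_le hv s

/-- The `i`-th of `m` equal parts of `[0, l]`. -/
def cell (m i : ℕ) : Set ℝ := Set.Ioc (c.cellLeft m i) (c.cellLeft m (i + 1))

theorem cellLeft_le {m : ℕ} (hm : 1 ≤ m) (i : ℕ) : c.cellLeft m i ≤ c.cellLeft m (i + 1) := by
  rw [cellLeft_succ]
  linarith [c.width_pos hm]

theorem measurableSet_cell (m i : ℕ) : MeasurableSet (c.cell m i) := measurableSet_Ioc

theorem segMeasure_cell_ne_top (m i : ℕ) : segMeasure c.l (c.cell m i) ≠ ⊤ :=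
  measure_ne_top _ _

/-- The normalized indicator of the `i`-th of `m` equal parts of `[0, l]`. -/
def cellFun (m : ℕ) (i : Fin m) : Lp ℂ 2 (segMeasure c.l) :=
  indicatorConstLp 2 (c.measurableSet_cell m i) (c.segMeasure_cell_ne_top m i)
    (((√(c.width m))⁻¹ : ℝ) : ℂ)

theorem restrict_cell {m : ℕ} (i : Fin m) :
    (segMeasure c.l).restrict (c.cell m i) = volume.restrict (c.cell m i) := by
  have hm : 1 ≤ m := Nat.one_le_of_lt i.2
  rw [segMeasure, Measure.restrict_restrict (c.measurableSet_cell m i)]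
  congr 1
  exact Set.inter_eq_left.2 (Set.Ioc_subset_Icc_self.trans (c.cell_subset hm i))

theorem disjoint_cell {m : ℕ} {i j : Fin m} (h : i ≠ j) : Disjoint (c.cell m i) (c.cell m j) := by
  have hm : 1 ≤ m := Nat.one_le_of_lt i.2
  have hmono : Monotone (c.cellLeft m) := monotone_nat_of_le_succ (c.cellLeft_le hm)
  exact hmono.pairwise_disjoint_on_Ioc_succ fun e => h (Fin.ext e)

theorem cellFun_orthonormal (m : ℕ) : Orthonormal ℂ (c.cellFun m) := by
  rw [orthonormal_iff_ite]
  intro i j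
  have hm : 1 ≤ m := Nat.one_le_of_lt i.2
  have hw := c.width_pos hm
  rw [cellFun, cellFun, L2.inner_indicatorConstLp_indicatorConstLp]
  split_ifs with hij
  · subst hij
    have h1 : (segMeasure c.l).real (c.cell m i) = c.width m := by
      have h2 : (segMeasure c.l) (c.cell m i) = volume (c.cell m i) := by
        rw [← Measure.restrict_apply_self, restrict_cell, Measure.restrict_apply_self]
      rw [Measure.real, h2, cell, Real.volume_Ioc, cellLeft_succ, add_sub_cancel_left,
        ENNReal.toReal_ofReal hw.le]
    rw [Set.inter_self, h1, RCLike.inner_apply, Complex.conj_ofReal, Complex.real_smul]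
    norm_cast
    rw [← mul_inv, Real.mul_self_sqrt hw.le, mul_inv_cancel₀ hw.ne']
  · rw [Set.disjoint_iff_inter_eq_empty.1 (c.disjoint_cell hij)]
    simp

theorem backField_cellFun {m : ℕ} (i : Fin m) (s : ℝ) :
    c.backField (c.cellFun m i) s = ((√(c.width m))⁻¹ : ℝ) *
      ∫ r in (c.cellLeft m i)..(c.cellLeft m (i + 1)), c.G r s := by
  have hm : 1 ≤ m := Nat.one_le_of_lt i.2
  rw [intervalIntegral.integral_of_le (c.cellLeft_le hm i), backField]
  have h1 : ∫ r, c.G r s * conj (c.cellFun m i r) ∂(segMeasure c.l)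
      = ∫ r, (c.cell m i).indicator (fun r => (((√(c.width m))⁻¹ : ℝ) : ℂ) * c.G r s) r
        ∂(segMeasure c.l) := by
    refine integral_congr_ae ?_
    filter_upwards [indicatorConstLp_coeFn (p := 2)
      (hs := (c.measurableSet_cell m i))
      (hμs := c.segMeasure_cell_ne_top m i) (c := (((√(c.width m))⁻¹ : ℝ) : ℂ))] with r hr
    have hr' : c.cellFun m i r = (c.cell m i).indicator (fun _ => (((√(c.width m))⁻¹ : ℝ) : ℂ)) r :=
      hr
    rw [hr']
    by_cases h : r ∈ c.cell m i
    · rw [Set.indicator_of_mem h, Set.indicator_of_mem h, Complex.conj_ofReal, mul_comm]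
    · rw [Set.indicator_of_notMem h, Set.indicator_of_notMem h, map_zero, mul_zero]
  rw [h1, integral_indicator (c.measurableSet_cell m i), restrict_cell,
    integral_const_mul]
  rfl

end Model

namespace Model

variable (c : Model)

/-! ### Quadrature errors and the rate -/

section Discretization

open Matrix

/-- The integral of the gains over the `i`-th of `m` equal parts of the destination line. -/
def cellGain (m i : ℕ) (s : ℝ) : ℂ := ∫ r in (c.cellLeft m i)..(c.cellLeft m (i + 1)), c.G r s

theorem continuous_cellGain (m i : ℕ) : Continuous (c.cellGain m i) :=
  intervalIntegral.continuous_parametric_intervalIntegral_of_continuous'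
    (f := fun s r => c.G r s) (c.continuous_G_comp continuous_snd continuous_fst) _ _

theorem compression_TE_apply {m : ℕ} (i j : Fin m) :
    compression c.TE (c.cellFun m) i j
      = c.P * ∫ s in (0 : ℝ)..c.l, (c.width m : ℂ)⁻¹ * (c.cellGain m i s * conj (c.cellGain m j s)) := by
  have hm : 1 ≤ m := Nat.one_le_of_lt i.2
  have hw := c.width_pos hm
  simp only [compression, of_apply]
  rw [inner_TE, integral_segMeasure c.l_pos.le]
  congr 1
  refine intervalIntegral.integral_congr fun s _ => ?_
  rw [backField_cellFun, backField_cellFun, map_mul, Complex.conj_ofReal]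
  have h1 : (((√(c.width m))⁻¹ : ℝ) : ℂ) * (((√(c.width m))⁻¹ : ℝ) : ℂ) = (c.width m : ℂ)⁻¹ := by
    rw [← Complex.ofReal_mul, ← mul_inv, Real.mul_self_sqrt hw.le, Complex.ofReal_inv]
  rw [← h1]
  simp only [cellGain]
  ring

/-- The normalized correlation matrix of the received signals. -/
def scaledKE (m1 m2 : ℕ) : Matrix (Fin m2) (Fin m2) ℂ :=
  ((c.P * c.width m1 * c.width m2 : ℝ) : ℂ) • (c.H m1 m2 * (c.H m1 m2)ᴴ)

theorem scaledKE_apply (m1 m2 : ℕ) (i j : Fin m2) :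
    c.scaledKE m1 m2 i j = c.P * (c.width m2 * (c.width m1 * ∑ k : Fin m1,
      c.G (c.antenna m2 i) (c.antenna m1 k) * conj (c.G (c.antenna m2 j) (c.antenna m1 k)))) := by
  rw [scaledKE, Matrix.smul_apply, Matrix.mul_apply, smul_eq_mul]
  push_cast
  simp only [H, conjTranspose_apply, of_apply, RCLike.star_def]
  ring

open scoped ComplexOrder in
theorem scaledKE_posSemidef (m1 m2 : ℕ) : (c.scaledKE m1 m2).PosSemidef := by
  refine (posSemidef_self_mul_conjTranspose (c.H m1 m2)).smul ?_
  have hl := c.l_pos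
  have hP := c.P_pos
  rw [Complex.zero_le_real]
  simp only [width]
  positivity

/-- The sum of the squared moduli of the gains. -/
def gainSum (m1 m2 : ℕ) : ℝ :=
  ∑ i : Fin m2, ∑ j : Fin m1, ‖c.G (c.antenna m2 i) (c.antenna m1 j)‖ ^ 2

theorem re_trace_scaledKE (m1 m2 : ℕ) :
    (c.scaledKE m1 m2).trace.re = c.P * (c.width m1 * c.width m2 * c.gainSum m1 m2) := by
  have h : (c.scaledKE m1 m2).trace = ((c.P * (c.width m1 * c.width m2 * c.gainSum m1 m2) : ℝ) : ℂ) := by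
    simp only [trace, diag_apply, scaledKE_apply, gainSum]
    push_cast
    simp only [Complex.mul_conj', ← Finset.mul_sum]
    ring
  rw [h, Complex.ofReal_re]

/-- Replacing the cell averages by the values at the centre. -/
theorem exists_cellGain_bound : ∃ B : ℝ, 0 ≤ B ∧
    ∀ s ∈ Set.Icc 0 c.l, ∀ (m : ℕ) (i j : Fin m),
      ‖(c.width m : ℂ)⁻¹ * (c.cellGain m i s * conj (c.cellGain m j s))
        - c.width m * (c.G (c.antenna m i) s * conj (c.G (c.antenna m j) s))‖
        ≤ B * c.width m ^ 3 := by
  obtain ⟨B, hB0, hB, hγ, -⟩ := c.exists_midpoint_bound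
  refine ⟨2 * (B * B), by positivity, fun s hs m i j => ?_⟩
  have hm : 1 ≤ m := Nat.one_le_of_lt i.2
  have hw := c.width_pos hm
  have hγb : ‖c.cellGain m j s‖ ≤ B * c.width m := by
    have h := intervalIntegral.norm_integral_le_of_norm_le_const (a := c.cellLeft m j)
      (b := c.cellLeft m (j + 1)) (f := fun r => c.G r s) (C := B) fun r hr => by
        rw [Set.uIoc_of_le (c.cellLeft_le hm j)] at hr
        exact hB r (c.cell_subset hm j ⟨hr.1.le, hr.2⟩) s hs
    rwa [cellLeft_succ, add_sub_cancel_left, abs_of_pos hw, ← cellLeft_succ] at h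
  have hwc : (c.width m : ℂ) ≠ 0 := by exact_mod_cast hw.ne'
  set a := c.cellGain m i s - c.width m * c.G (c.antenna m i) s with ha
  set b := c.cellGain m j s - c.width m * c.G (c.antenna m j) s with hb
  have e : (c.width m : ℂ)⁻¹ * (c.cellGain m i s * conj (c.cellGain m j s))
      - c.width m * (c.G (c.antenna m i) s * conj (c.G (c.antenna m j) s))
      -- The factors are replaced one at a time. The first term has w⁻¹, which is compensated by
      -- |cellGain| ≤ B w.
      = (c.width m : ℂ)⁻¹ * (a * conj (c.cellGain m j s))
        + c.G (c.antenna m i) s * conj b := by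
    rw [ha, hb, map_sub, map_mul, Complex.conj_ofReal]
    field_simp
    ring
  have ha' : ‖a‖ ≤ B * c.width m ^ 3 := hγ s hs m i
  have hb' : ‖b‖ ≤ B * c.width m ^ 3 := hγ s hs m j
  have hGi := hB _ (c.antenna_mem i) s hs
  rw [e]
  have h1 : ‖(c.width m : ℂ)⁻¹ * (a * conj (c.cellGain m j s))‖ ≤ B * B * c.width m ^ 3 := by
    rw [norm_mul, norm_mul, RCLike.norm_conj, norm_inv, Complex.norm_real, Real.norm_eq_abs,
      abs_of_pos hw, inv_mul_le_iff₀ hw]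
    calc ‖a‖ * ‖c.cellGain m j s‖ ≤ (B * c.width m ^ 3) * (B * c.width m) :=
          mul_le_mul ha' hγb (norm_nonneg _) (by positivity)
      _ = _ := by ring
  have h2 : ‖c.G (c.antenna m i) s * conj b‖ ≤ B * B * c.width m ^ 3 := by
    rw [norm_mul, RCLike.norm_conj]
    calc _ ≤ B * (B * c.width m ^ 3) := mul_le_mul hGi hb' (norm_nonneg _) hB0
      _ = _ := by ring
  linarith [norm_add_le ((c.width m : ℂ)⁻¹ * (a * conj (c.cellGain m j s)))
    (c.G (c.antenna m i) s * conj b)]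

theorem continuous_G_mul_conj (r r' : ℝ) : Continuous fun s => c.G r s * conj (c.G r' s) :=
  (c.continuous_G_comp continuous_const continuous_id).mul
    (Complex.continuous_conj.comp (c.continuous_G_comp continuous_const continuous_id))

theorem continuous_cellGain_mul_conj (m i j : ℕ) :
    Continuous fun s => (c.width m : ℂ)⁻¹ * (c.cellGain m i s * conj (c.cellGain m j s)) :=
  continuous_const.mul ((c.continuous_cellGain m i).mul
    (Complex.continuous_conj.comp (c.continuous_cellGain m j)))

/-- Cell averages are replaced by centre values on the destination side, then the source integral by
its midpoint sum. The extra factor w_2 = l/m_2 supplies the ε / card required by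
`logDet_one_add_le`. -/
theorem exists_compression_sub_scaledKE_bound : ∃ C : ℝ, 0 ≤ C ∧
    ∀ m1 m2 : ℕ, 1 ≤ m1 → ∀ i j : Fin m2,
      ‖compression c.TE (c.cellFun m2) i j - c.scaledKE m1 m2 i j‖
        ≤ C * (c.width m1 ^ 2 + c.width m2 ^ 2) * c.width m2 := by
  obtain ⟨B1, hB1, hγ⟩ := c.exists_cellGain_bound
  obtain ⟨B, hB0, -, -, -, hmid⟩ := c.exists_midpoint_bound
  have hl := c.l_pos
  have hP := c.P_pos
  refine ⟨c.P * c.l * (B1 + B), by positivity, fun m1 m2 hm1 i j => ?_⟩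
  have hm2 : 1 ≤ m2 := Nat.one_le_of_lt i.2
  have hw := c.width_pos hm2
  have hw1 := c.width_pos hm1
  set S := ∑ k : Fin m1,
      c.G (c.antenna m2 i) (c.antenna m1 k) * conj (c.G (c.antenna m2 j) (c.antenna m1 k)) with hS
  set A := ∫ s in (0 : ℝ)..c.l,
    (c.width m2 : ℂ)⁻¹ * (c.cellGain m2 i s * conj (c.cellGain m2 j s)) with hA
  set D := ∫ s in (0 : ℝ)..c.l, c.G (c.antenna m2 i) s * conj (c.G (c.antenna m2 j) s) with hD
  have h1 : ‖A - c.width m2 * D‖ ≤ B1 * c.width m2 ^ 3 * c.l := by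
    have hc : Continuous fun s => (c.width m2 : ℂ) *
        (c.G (c.antenna m2 i) s * conj (c.G (c.antenna m2 j) s)) :=
      continuous_const.mul (c.continuous_G_mul_conj _ _)
    rw [hA, hD, ← intervalIntegral.integral_const_mul, ← intervalIntegral.integral_sub
      ((c.continuous_cellGain_mul_conj m2 i j).intervalIntegrable _ _) (hc.intervalIntegrable _ _)]
    have h := intervalIntegral.norm_integral_le_of_norm_le_const (a := (0 : ℝ)) (b := c.l)
      (f := fun s => (c.width m2 : ℂ)⁻¹ * (c.cellGain m2 i s * conj (c.cellGain m2 j s))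
        - c.width m2 * (c.G (c.antenna m2 i) s * conj (c.G (c.antenna m2 j) s)))
      (C := B1 * c.width m2 ^ 3) fun s hs => by
        rw [Set.uIoc_of_le hl.le] at hs
        exact hγ s ⟨hs.1.le, hs.2⟩ m2 i j
    rwa [sub_zero, abs_of_pos hl] at h
  have h2 : ‖D - c.width m1 * S‖ ≤ B * c.l * c.width m1 ^ 2 :=
    hmid _ (c.antenna_mem i) _ (c.antenna_mem j) m1 hm1
  rw [compression_TE_apply, scaledKE_apply, ← mul_sub]
  have e : A - c.width m2 * (c.width m1 * S)
      = (A - c.width m2 * D) + c.width m2 * (D - c.width m1 * S) := by ring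
  rw [← hA, ← hS, e, norm_mul, Complex.norm_real, Real.norm_eq_abs, abs_of_pos hP]
  have h3 : ‖(c.width m2 : ℂ) * (D - c.width m1 * S)‖ ≤ c.width m2 * (B * c.l * c.width m1 ^ 2) := by
    rw [norm_mul, Complex.norm_real, Real.norm_eq_abs, abs_of_pos hw]
    exact mul_le_mul_of_nonneg_left h2 hw.le
  have h4 := (norm_add_le (A - c.width m2 * D) (c.width m2 * (D - c.width m1 * S))).trans
    (add_le_add h1 h3)
  refine (mul_le_mul_of_nonneg_left h4 hP.le).trans ?_
  -- These are the two cross terms by which the claimed bound exceeds the one obtained.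
  have h5 : 0 ≤ c.P * c.l * c.width m2 * (B * c.width m2 ^ 2 + B1 * c.width m1 ^ 2) := by positivity
  nlinarith [h5]

theorem mul_conj_G (r s : ℝ) : c.G r s * conj (c.G r s) = ((‖c.G r s‖ ^ 2 : ℝ) : ℂ) := by
  rw [Complex.mul_conj', Complex.ofReal_pow]

/-- On each cell, both the integral of |G|² and the normalized square of the cell average are within
O(w³) of w |G|² at the centre; there are m = l/w cells. -/
theorem exists_trace_sub_bound : ∃ C : ℝ, 0 ≤ C ∧ ∀ m : ℕ, 1 ≤ m →
    (c.P * ∫ s in (0 : ℝ)..c.l, ∫ r in (0 : ℝ)..c.l, ‖c.G r s‖ ^ 2)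
      - (compression c.TE (c.cellFun m)).trace.re ≤ C * c.width m ^ 2 := by
  obtain ⟨B1, hB1, hγ⟩ := c.exists_cellGain_bound
  obtain ⟨B, hB0, -, -, hsq, -⟩ := c.exists_midpoint_bound
  have hl := c.l_pos
  have hP := c.P_pos
  refine ⟨c.P * c.l * c.l * (B1 + B), by positivity, fun m hm => ?_⟩
  have hw := c.width_pos hm
  set F : ℝ → ℂ := fun s => ∑ i : Fin m,
    (c.width m : ℂ)⁻¹ * (c.cellGain m i s * conj (c.cellGain m i s)) with hF
  have hFc : Continuous F := continuous_finsetSum _ fun i _ => c.continuous_cellGain_mul_conj m i i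
  have htr : (compression c.TE (c.cellFun m)).trace = c.P * ∫ s in (0 : ℝ)..c.l, F s := by
    rw [hF, intervalIntegral.integral_finsetSum
      fun (i : Fin m) _ => (c.continuous_cellGain_mul_conj m i i).intervalIntegrable _ _,
      Finset.mul_sum]
    exact Finset.sum_congr rfl fun i _ => c.compression_TE_apply i i
  have hτ : ((c.P * ∫ s in (0 : ℝ)..c.l, ∫ r in (0 : ℝ)..c.l, ‖c.G r s‖ ^ 2 : ℝ) : ℂ)
      = c.P * ∫ s in (0 : ℝ)..c.l, ∫ r in (0 : ℝ)..c.l, c.G r s * conj (c.G r s) := by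
    simp only [mul_conj_G, intervalIntegral.integral_ofReal, Complex.ofReal_mul]
  have hEc : Continuous fun s => ∫ r in (0 : ℝ)..c.l, c.G r s * conj (c.G r s) := by
    simp only [mul_conj_G, intervalIntegral.integral_ofReal]
    exact Complex.continuous_ofReal.comp c.continuous_integral_norm_sq_G
  have hpt : ∀ s ∈ Set.Icc 0 c.l, ‖(∫ r in (0 : ℝ)..c.l, c.G r s * conj (c.G r s)) - F s‖
      ≤ c.l * (B1 + B) * c.width m ^ 2 := by
    intro s hs
    have hc : Continuous fun r => c.G r s * conj (c.G r s) :=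
      (c.continuous_G_comp continuous_id continuous_const).mul
        (Complex.continuous_conj.comp (c.continuous_G_comp continuous_id continuous_const))
    rw [← c.sum_integral_cells hm hc, hF, ← Finset.sum_sub_distrib]
    have h : ∀ i ∈ (Finset.univ : Finset (Fin m)),
        ‖(∫ r in (c.cellLeft m i)..(c.cellLeft m (i + 1)), c.G r s * conj (c.G r s))
          - (c.width m : ℂ)⁻¹ * (c.cellGain m i s * conj (c.cellGain m i s))‖
        ≤ (B1 + B) * c.width m ^ 3 := fun i _ => by
      have h1 := hγ s hs m i i
      rw [norm_sub_rev] at h1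
      have := norm_sub_le_norm_sub_add_norm_sub
        (∫ r in (c.cellLeft m i)..(c.cellLeft m (i + 1)), c.G r s * conj (c.G r s))
        (c.width m * (c.G (c.antenna m i) s * conj (c.G (c.antenna m i) s)))
        ((c.width m : ℂ)⁻¹ * (c.cellGain m i s * conj (c.cellGain m i s)))
      linarith [hsq s hs m i]
    refine (norm_sum_le_of_le _ h).trans (le_of_eq ?_)
    rw [Finset.sum_const, Finset.card_univ, Fintype.card_fin, nsmul_eq_mul,
      ← c.natCast_mul_width hm]
    ring
  have hint := intervalIntegral.norm_integral_le_of_norm_le_const (a := (0 : ℝ)) (b := c.l)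
    (f := fun s => (∫ r in (0 : ℝ)..c.l, c.G r s * conj (c.G r s)) - F s)
    (C := c.l * (B1 + B) * c.width m ^ 2) fun s hs => by
      rw [Set.uIoc_of_le hl.le] at hs
      exact hpt s ⟨hs.1.le, hs.2⟩
  rw [intervalIntegral.integral_sub (hEc.intervalIntegrable _ _) (hFc.intervalIntegrable _ _),
    sub_zero, abs_of_pos hl] at hint
  have hre := congrArg Complex.re hτ
  rw [Complex.ofReal_re] at hre
  rw [hre, htr, ← Complex.sub_re, ← mul_sub]
  refine (Complex.re_le_norm _).trans ?_
  rw [norm_mul, Complex.norm_real, Real.norm_eq_abs, abs_of_pos hP]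
  exact (mul_le_mul_of_nonneg_left hint hP.le).trans (le_of_eq (by ring))

theorem continuous_integral_norm_sq_G' :
    Continuous fun r => ∫ s in (0 : ℝ)..c.l, ‖c.G r s‖ ^ 2 := by
  refine intervalIntegral.continuous_parametric_intervalIntegral_of_continuous'
    (f := fun r s => ‖c.G r s‖ ^ 2) ?_ 0 c.l
  exact (c.continuous_G_comp continuous_fst continuous_snd).norm.pow 2

theorem exists_gainSum_bound : ∃ C : ℝ, 0 ≤ C ∧ ∀ m1 m2 : ℕ, 1 ≤ m1 → 1 ≤ m2 →
    |(∫ r in (0 : ℝ)..c.l, ∫ s in (0 : ℝ)..c.l, ‖c.G r s‖ ^ 2)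
      - c.width m1 * c.width m2 * c.gainSum m1 m2| ≤ C * (c.width m1 ^ 2 + c.width m2 ^ 2) := by
  obtain ⟨B, hB0, -, -, hsq, hmid⟩ := c.exists_midpoint_bound
  have hl := c.l_pos
  refine ⟨B * c.l * c.l, by positivity, fun m1 m2 hm1 hm2 => ?_⟩
  have hw1 := c.width_pos hm1
  have hw2 := c.width_pos hm2
  have hcr : ∀ s, Continuous fun r => ‖c.G r s‖ ^ 2 := fun s =>
    (c.continuous_G_comp continuous_id continuous_const).norm.pow 2
  -- source side
  have h1 : ∀ r ∈ Set.Icc 0 c.l, ‖(∫ s in (0 : ℝ)..c.l, ‖c.G r s‖ ^ 2)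
      - c.width m1 * ∑ j : Fin m1, ‖c.G r (c.antenna m1 j)‖ ^ 2‖ ≤ B * c.l * c.width m1 ^ 2 :=
    fun r hr => by
      have h := hmid r hr r hr m1 hm1
      simp only [mul_conj_G, intervalIntegral.integral_ofReal] at h
      rw [← Complex.norm_real]
      push_cast at h ⊢
      exact h
  have h2 : |(∫ r in (0 : ℝ)..c.l, ∫ s in (0 : ℝ)..c.l, ‖c.G r s‖ ^ 2)
      - c.width m1 * ∑ j : Fin m1, ∫ r in (0 : ℝ)..c.l, ‖c.G r (c.antenna m1 j)‖ ^ 2|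
      ≤ B * c.l * c.width m1 ^ 2 * c.l := by
    have hc : Continuous fun r => c.width m1 * ∑ j : Fin m1, ‖c.G r (c.antenna m1 j)‖ ^ 2 :=
      continuous_const.mul (continuous_finsetSum _ fun j _ => hcr _)
    rw [← intervalIntegral.integral_finsetSum fun j _ => (hcr _).intervalIntegrable _ _,
      ← intervalIntegral.integral_const_mul, ← intervalIntegral.integral_sub
      (c.continuous_integral_norm_sq_G'.intervalIntegrable _ _) (hc.intervalIntegrable _ _)]
    have h := intervalIntegral.norm_integral_le_of_norm_le_const (a := (0 : ℝ)) (b := c.l)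
      (f := fun r => (∫ s in (0 : ℝ)..c.l, ‖c.G r s‖ ^ 2)
        - c.width m1 * ∑ j : Fin m1, ‖c.G r (c.antenna m1 j)‖ ^ 2)
      (C := B * c.l * c.width m1 ^ 2) fun r hr => by
        rw [Set.uIoc_of_le hl.le] at hr
        exact h1 r ⟨hr.1.le, hr.2⟩
    rwa [sub_zero, abs_of_pos hl] at h
  -- destination side
  have h3 : ∀ s ∈ Set.Icc 0 c.l, |(∫ r in (0 : ℝ)..c.l, ‖c.G r s‖ ^ 2)
      - c.width m2 * ∑ i : Fin m2, ‖c.G (c.antenna m2 i) s‖ ^ 2| ≤ B * c.l * c.width m2 ^ 2 := by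
    intro s hs
    rw [← c.sum_integral_cells hm2 (hcr s), Finset.mul_sum, ← Finset.sum_sub_distrib]
    have h : ∀ i ∈ (Finset.univ : Finset (Fin m2)),
        |(∫ r in (c.cellLeft m2 i)..(c.cellLeft m2 (i + 1)), ‖c.G r s‖ ^ 2)
          - c.width m2 * ‖c.G (c.antenna m2 i) s‖ ^ 2| ≤ B * c.width m2 ^ 3 := fun i _ => by
      have h := hsq s hs m2 i
      simp only [mul_conj_G, intervalIntegral.integral_ofReal] at h
      rw [← Real.norm_eq_abs, ← Complex.norm_real]
      push_cast at h ⊢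
      exact h
    refine (Finset.abs_sum_le_sum_abs _ _).trans ((Finset.sum_le_sum h).trans (le_of_eq ?_))
    rw [Finset.sum_const, Finset.card_univ, Fintype.card_fin, nsmul_eq_mul,
      ← c.natCast_mul_width hm2]
    ring
  have h4 : |c.width m1 * (∑ j : Fin m1, ∫ r in (0 : ℝ)..c.l, ‖c.G r (c.antenna m1 j)‖ ^ 2)
      - c.width m1 * c.width m2 * c.gainSum m1 m2| ≤ B * c.l * c.l * c.width m2 ^ 2 := by
    have e : c.width m1 * (∑ j : Fin m1, ∫ r in (0 : ℝ)..c.l, ‖c.G r (c.antenna m1 j)‖ ^ 2)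
        - c.width m1 * c.width m2 * c.gainSum m1 m2
        = c.width m1 * ∑ j : Fin m1, ((∫ r in (0 : ℝ)..c.l, ‖c.G r (c.antenna m1 j)‖ ^ 2)
          - c.width m2 * ∑ i : Fin m2, ‖c.G (c.antenna m2 i) (c.antenna m1 j)‖ ^ 2) := by
      rw [gainSum, Finset.sum_comm, Finset.sum_sub_distrib, ← Finset.mul_sum]
      ring
    rw [e, abs_mul, abs_of_pos hw1]
    have h5 := (Finset.abs_sum_le_sum_abs _ _).trans
      (Finset.sum_le_sum fun (j : Fin m1) (_ : j ∈ Finset.univ) => h3 _ (c.antenna_mem j))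
    rw [Finset.sum_const, Finset.card_univ, Fintype.card_fin, nsmul_eq_mul] at h5
    refine (mul_le_mul_of_nonneg_left h5 hw1.le).trans (le_of_eq ?_)
    linear_combination (B * c.l * c.width m2 ^ 2) * c.natCast_mul_width hm1
  have h6 := abs_sub_le (∫ r in (0 : ℝ)..c.l, ∫ s in (0 : ℝ)..c.l, ‖c.G r s‖ ^ 2)
    (c.width m1 * ∑ j : Fin m1, ∫ r in (0 : ℝ)..c.l, ‖c.G r (c.antenna m1 j)‖ ^ 2)
    (c.width m1 * c.width m2 * c.gainSum m1 m2)
  linarith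

theorem gainSum_pos {m1 m2 : ℕ} (hm1 : 1 ≤ m1) (hm2 : 1 ≤ m2) : 0 < c.gainSum m1 m2 := by
  have : Nonempty (Fin m1) := ⟨⟨0, hm1⟩⟩
  have : Nonempty (Fin m2) := ⟨⟨0, hm2⟩⟩
  exact Finset.sum_pos (fun i _ => Finset.sum_pos
    (fun j _ => by have := norm_pos_iff.2 (c.G_ne_zero (c.antenna m2 i) (c.antenna m1 j)); positivity)
    Finset.univ_nonempty) Finset.univ_nonempty

theorem integral_norm_sq_G_pos :
    0 < ∫ r in (0 : ℝ)..c.l, ∫ s in (0 : ℝ)..c.l, ‖c.G r s‖ ^ 2 := by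
  have hl := c.l_pos
  have h : ∀ r s, 0 < ‖c.G r s‖ ^ 2 := fun r s => by
    have := norm_pos_iff.2 (c.G_ne_zero r s)
    positivity
  refine intervalIntegral.intervalIntegral_pos_of_pos_on
    (c.continuous_integral_norm_sq_G'.intervalIntegrable _ _) (fun r _ => ?_) hl
  refine intervalIntegral.intervalIntegral_pos_of_pos_on
    (Continuous.intervalIntegrable ?_ _ _) (fun s _ => h r s) hl
  exact (c.continuous_G_comp continuous_const continuous_id).norm.pow 2

/-- K_N is scalar, so the quotient of determinants is det (1 + K_E / (n_2/2)); inserting n_2 and the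
cell widths leaves the factor ∬|G|² / (w_1 w_2 ∑|G|²). -/
theorem I2_eq {m1 m2 : ℕ} (hm1 : 1 ≤ m1) (hm2 : 1 ≤ m2) :
    c.I2 m1 m2 = logDet (1 + (((∫ r in (0 : ℝ)..c.l, ∫ s in (0 : ℝ)..c.l, ‖c.G r s‖ ^ 2)
      / (c.width m1 * c.width m2 * c.gainSum m1 m2) : ℝ) : ℂ) •
        ((((c.n0 / 2)⁻¹ : ℝ) : ℂ) • c.scaledKE m1 m2)) := by
  have hS := c.gainSum_pos hm1 hm2
  have hN := c.integral_norm_sq_G_pos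
  have hw1 := c.width_pos hm1
  have hw2 := c.width_pos hm2
  have hn := c.n0_pos
  set N := ∫ r in (0 : ℝ)..c.l, ∫ s in (0 : ℝ)..c.l, ‖c.G r s‖ ^ 2 with hNdef
  have hν : c.n2 m1 m2 / 2 = c.n0 * c.gainSum m1 m2 / N / 2 := rfl
  have hν0 : 0 < c.n2 m1 m2 / 2 := by
    rw [hν]
    positivity
  set ν := c.n2 m1 m2 / 2 with hνdef
  have hνc : (ν : ℂ) ≠ 0 := by exact_mod_cast hν0.ne'
  have hKE : ((N / (c.width m1 * c.width m2 * c.gainSum m1 m2) : ℝ) : ℂ) •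
        ((((c.n0 / 2)⁻¹ : ℝ) : ℂ) • c.scaledKE m1 m2) = (ν : ℂ)⁻¹ • c.KE m1 m2 := by
    rw [KE, KJ, scaledKE, Matrix.mul_smul, Matrix.mul_one, Matrix.smul_mul, smul_smul, smul_smul, smul_smul]
    congr 1
    rw [← Complex.ofReal_inv, ← Complex.ofReal_mul, ← Complex.ofReal_mul, ← Complex.ofReal_mul, hν]
    congr 1
    field_simp
  have hsum : c.KN m1 m2 + c.KE m1 m2 = (ν : ℂ) • (1 + (ν : ℂ)⁻¹ • c.KE m1 m2) := by
    rw [smul_add, smul_smul, mul_inv_cancel₀ hνc, one_smul, KN, ← hνdef]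
  rw [I2, hKE, logDet, hsum, KN, ← hνdef, det_smul, det_smul, det_one, mul_one,
    mul_div_cancel_left₀ _ (pow_ne_zero _ hνc)]

open scoped ComplexOrder in
/-- The rate of convergence, and summability of the contributions of the eigenvalues. -/
theorem summable_eigenInfo_and_rate : Summable c.eigenInfo ∧
    ∃ C : ℝ, 0 ≤ C ∧ ∀ m1 m2 : ℕ, 1 ≤ m1 → 1 ≤ m2 →
      |c.I0 - c.I2 m1 m2| ≤ C * (c.width m1 ^ 2 + c.width m2 ^ 2) := by
  have hl := c.l_pos
  have hP := c.P_pos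
  have hb : 0 < c.n0 / 2 := half_pos c.n0_pos
  obtain ⟨I, hI, hsand⟩ := logDet_compression hb c.TE_traceBound c.TE_isSymmetric
    c.re_inner_TE_self_nonneg
  have hI' : HasSum c.eigenInfo I := hI
  have hI0 : c.I0 = I := hI'.tsum_eq
  refine ⟨hI'.summable, ?_⟩
  obtain ⟨C1, hC1, h1⟩ := c.exists_trace_sub_bound
  obtain ⟨C2, hC2, h2⟩ := c.exists_compression_sub_scaledKE_bound
  obtain ⟨C3, hC3, h3⟩ := c.exists_gainSum_bound
  obtain ⟨B, hB0, hB, -⟩ := c.exists_midpoint_bound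
  set τ := c.P * ∫ s in (0 : ℝ)..c.l, ∫ r in (0 : ℝ)..c.l, ‖c.G r s‖ ^ 2 with hτ
  set b := c.n0 / 2 with hbdef
  -- The empty orthonormal family has partial trace 0.
  have hτ0 : 0 ≤ τ := by
    have := c.TE_traceBound 0 Fin.elim0 ⟨fun i => i.elim0, fun i => i.elim0⟩
    simpa using this
  -- a common bound for the traces
  set R := τ + c.P * (c.l * c.l * B ^ 2) with hR
  have hR0 : 0 ≤ R := by positivity
  -- The three summands bound, in order, the trace lost by compression, the entrywise quadrature
  -- error, and the deviation of q from 1.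
  refine ⟨C1 / b + c.l * C2 / b * (1 + R / b) + c.P * C3 / b, by positivity,
    fun m1 m2 hm1 hm2 => ?_⟩
  have hw1 := c.width_pos hm1
  have hw2 := c.width_pos hm2
  have : Nonempty (Fin m2) := ⟨⟨0, hm2⟩⟩
  set W := c.width m1 ^ 2 + c.width m2 ^ 2 with hW
  have hW0 : 0 ≤ W := by positivity
  set N := compression c.TE (c.cellFun m2) with hN
  set N' := c.scaledKE m1 m2 with hN'
  have hbinv : (0 : ℂ) ≤ ((b⁻¹ : ℝ) : ℂ) := by
    rw [Complex.zero_le_real]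
    positivity
  have hXpos : (((b⁻¹ : ℝ) : ℂ) • N).PosSemidef :=
    (compression_posSemidef c.TE_isSymmetric c.re_inner_TE_self_nonneg _).smul hbinv
  have hYpos : (((b⁻¹ : ℝ) : ℂ) • N').PosSemidef := (c.scaledKE_posSemidef m1 m2).smul hbinv
  have htrX : (((b⁻¹ : ℝ) : ℂ) • N).trace.re = N.trace.re / b := by
    rw [trace_smul, smul_eq_mul, Complex.re_ofReal_mul, inv_mul_eq_div]
  have htrY : (((b⁻¹ : ℝ) : ℂ) • N').trace.re = N'.trace.re / b := by
    rw [trace_smul, smul_eq_mul, Complex.re_ofReal_mul, inv_mul_eq_div]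
  have hNR : N.trace.re ≤ R := by
    have := c.TE_traceBound m2 _ (c.cellFun_orthonormal m2)
    have h4 : N.trace.re ≤ τ := by
      rw [trace, Complex.re_sum]
      exact this
    have : 0 ≤ c.P * (c.l * c.l * B ^ 2) := by positivity
    linarith
  have hN'R : N'.trace.re ≤ R := by
    rw [hN', re_trace_scaledKE]
    have h4 : c.gainSum m1 m2 ≤ m2 * (m1 * B ^ 2) := by
      calc c.gainSum m1 m2 ≤ ∑ _i : Fin m2, ∑ _j : Fin m1, B ^ 2 :=
            Finset.sum_le_sum fun i _ => Finset.sum_le_sum fun j _ =>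
              pow_le_pow_left₀ (norm_nonneg _) (hB _ (c.antenna_mem i) _ (c.antenna_mem j)) 2
        _ = _ := by simp
    have h5 : c.width m1 * c.width m2 * c.gainSum m1 m2 ≤ c.l * c.l * B ^ 2 := by
      refine (mul_le_mul_of_nonneg_left h4 (by positivity)).trans (le_of_eq ?_)
      calc _ = (m1 * c.width m1) * (m2 * c.width m2) * B ^ 2 := by ring
        _ = _ := by rw [c.natCast_mul_width hm1, c.natCast_mul_width hm2]
    have := mul_le_mul_of_nonneg_left h5 hP.le
    linarith
  -- the three errors
  have e1 := hsand m2 _ (c.cellFun_orthonormal m2)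
  have e1' : (τ - N.trace.re) / b ≤ C1 / b * W := by
    rw [div_mul_eq_mul_div]
    refine div_le_div_of_nonneg_right ((h1 m2 hm2).trans ?_) hb.le
    exact mul_le_mul_of_nonneg_left (by rw [hW]; linarith [sq_nonneg (c.width m1)]) hC1
  set ε := c.l * C2 / b * W with hε
  have hε0 : 0 ≤ ε := by positivity
  have hentry : ∀ i j, ‖(((b⁻¹ : ℝ) : ℂ) • N) i j - (((b⁻¹ : ℝ) : ℂ) • N') i j‖
      ≤ ε / Fintype.card (Fin m2) := fun i j => by
    rw [Matrix.smul_apply, Matrix.smul_apply, ← smul_sub, norm_smul, Complex.norm_real, norm_inv,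
      Real.norm_eq_abs, abs_of_pos hb, Fintype.card_fin]
    refine (mul_le_mul_of_nonneg_left (h2 m1 m2 hm1 i j) (by positivity)).trans (le_of_eq ?_)
    rw [← hW, hε, show c.width m2 = c.l / m2 from rfl]
    field_simp
  have e2 := logDet_one_add_le hXpos hYpos hentry
  have e3 := logDet_one_add_le hYpos hXpos fun i j => by
    rw [norm_sub_rev]
    exact hentry i j
  rw [htrY] at e2
  rw [htrX] at e3
  have e2' : ε * (1 + N'.trace.re / b) ≤ ε * (1 + R / b) := by gcongr
  have e3' : ε * (1 + N.trace.re / b) ≤ ε * (1 + R / b) := by gcongr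
  set t := c.width m1 * c.width m2 * c.gainSum m1 m2 with ht
  have htpos : 0 < t := mul_pos (mul_pos hw1 hw2) (c.gainSum_pos hm1 hm2)
  have e4 := logDet_one_add_smul_sub_le hYpos
    (q := (∫ r in (0 : ℝ)..c.l, ∫ s in (0 : ℝ)..c.l, ‖c.G r s‖ ^ 2) / t)
    (div_pos c.integral_norm_sq_G_pos htpos).le
  rw [hbdef, hN', ht, ← c.I2_eq hm1 hm2, ← ht, ← hN', ← hbdef, htrY, hN', re_trace_scaledKE, ← ht,
    div_sub_one htpos.ne', abs_div, abs_of_pos htpos] at e4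
  -- The factor t in the trace of N' cancels the denominator of q - 1, so no lower bound on t is
  -- needed.
  have e4' : |(∫ r in (0 : ℝ)..c.l, ∫ s in (0 : ℝ)..c.l, ‖c.G r s‖ ^ 2) - t| / t * (c.P * t / b)
      ≤ c.P * C3 / b * W := by
    have h6 := mul_le_mul_of_nonneg_left (h3 m1 m2 hm1 hm2) (div_pos hP hb).le
    refine (le_of_eq ?_).trans (h6.trans (le_of_eq ?_))
    · rw [← ht]
      field_simp
    · ring
  have e5 := abs_le.1 (e4.trans e4')
  have hfin : (C1 / b + c.l * C2 / b * (1 + R / b) + c.P * C3 / b) * W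
      = C1 / b * W + ε * (1 + R / b) + c.P * C3 / b * W := by
    rw [hε]
    ring
  have hC1W : 0 ≤ C1 / b * W := by positivity
  rw [hfin, hI0, abs_le]
  constructor <;> linarith [e1.1, e1.2, e5.1, e5.2]

end Discretization

end Model

end EIT

end

/-! ### The main theorem -/

theorem theorem2 (c : EIT.Model) :
    -- the sum that defines `c.I0` runs over all eigenvalues, and it converges
    (∀ z : ℂ, c.TE.HasEigenvalue z → ∃ x : ℝ, 0 ≤ x ∧ z = (x : ℂ)) ∧
    (∀ x : ℝ, x ≠ 0 → FiniteDimensional ℂ (c.TE.eigenspace (x : ℂ))) ∧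
    Summable c.eigenInfo ∧
    -- convergence, and its rate
    Tendsto (fun m : ℕ × ℕ => c.I2 m.1 m.2) (atTop ×ˢ atTop) (𝓝 c.I0) ∧
    ∃ C : ℝ, ∀ m1 m2 : ℕ, 1 ≤ m1 → 1 ≤ m2 →
      |c.I0 - c.I2 m1 m2| ≤ C / ((min m1 m2 : ℕ) : ℝ) ^ 2 := by
  have hl := c.l_pos
  obtain ⟨hsumm, C, hC0, hC⟩ := c.summable_eigenInfo_and_rate
  have hrate : ∀ m1 m2 : ℕ, 1 ≤ m1 → 1 ≤ m2 →
      |c.I0 - c.I2 m1 m2| ≤ 2 * C * c.l ^ 2 / ((min m1 m2 : ℕ) : ℝ) ^ 2 := by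
    intro m1 m2 hm1 hm2
    have hmin : (0 : ℝ) < ((min m1 m2 : ℕ) : ℝ) := by exact_mod_cast lt_min hm1 hm2
    -- Both widths are at most l / min(m1, m2), whence the constant 2 C l².
    have hw : ∀ m : ℕ, min m1 m2 ≤ m → c.width m ^ 2 ≤ c.l ^ 2 / ((min m1 m2 : ℕ) : ℝ) ^ 2 :=
      fun m hm => by
        have hm' : ((min m1 m2 : ℕ) : ℝ) ≤ m := by exact_mod_cast hm
        rw [EIT.Model.width, div_pow]
        gcongr
    refine (hC m1 m2 hm1 hm2).trans ?_
    refine (mul_le_mul_of_nonneg_left (add_le_add (hw m1 (min_le_left _ _))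
      (hw m2 (min_le_right _ _))) hC0).trans (le_of_eq ?_)
    ring
  refine ⟨fun z hz => ?_, (EIT.exists_eigenbasis c.TE_traceBound c.TE_isSymmetric
    c.re_inner_TE_self_nonneg).1, hsumm, ?_, 2 * C * c.l ^ 2, hrate⟩
  · obtain ⟨x, rfl⟩ := Complex.conj_eq_iff_real.1 (c.TE_isSymmetric.conj_eigenvalue_eq_self hz)
    exact ⟨x, eigenvalue_nonneg_of_nonneg hz c.re_inner_TE_self_nonneg, rfl⟩
  · have hmin : Tendsto (fun m : ℕ × ℕ => min m.1 m.2) (atTop ×ˢ atTop) atTop :=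
      tendsto_atTop.2 fun k => by
        filter_upwards [tendsto_fst.eventually (eventually_ge_atTop k),
          tendsto_snd.eventually (eventually_ge_atTop k)] with m h1 h2 using le_min h1 h2
    have hlim : Tendsto (fun m : ℕ × ℕ => 2 * C * c.l ^ 2 / ((min m.1 m.2 : ℕ) : ℝ) ^ 2)
        (atTop ×ˢ atTop) (𝓝 0) :=
      ((tendsto_pow_atTop two_ne_zero).comp
        (tendsto_natCast_atTop_atTop.comp hmin)).const_div_atTop _
    rw [tendsto_iff_dist_tendsto_zero]
    refine squeeze_zero' (Eventually.of_forall fun _ => dist_nonneg) ?_ hlim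
    filter_upwards [tendsto_fst.eventually (eventually_ge_atTop 1),
      tendsto_snd.eventually (eventually_ge_atTop 1)] with m h1 h2
    rw [dist_comm, Real.dist_eq]
    exact hrate m.1 m.2 h1 h2
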